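/- **Setting.** Let $\mathbb H^n=\mathbb R^{2n+1}$ with points $(x,y,t)$, left-invariant frame $Z_j=X_j=\partial_{x_j}+y_j\partial_t$, $Z_{n+j}=Y_j=\partial_{y_j}-x_j\partial_t$ $(1\le j\le n)$, $Z_{2n+1}=T=\partial_t$, and the Riemannian metric $\langle\cdot,\cdot\rangle$ that makes this frame orthonormal. Let $\mathcal H=\operatorname{span}\{X_j,Y_j\}$ be the horizontal distribution, let $J$ be the linear map with $J(X_j)=Y_j$, $J(Y_j)=-X_j$, $J(T)=0$, and let $\nabla$ be the pseudohermitian connection, that is, the metric connection with torsion $\nabla_XY-\nabla_YX-[X,Y]=2\langle J(X),Y\rangle T$; equivalently $\nabla Z_i=0$ for all $i$. Let $S$ be a smooth immersed hypersurface without boundary in $\mathbb H^n$. A point $p\in S$ is non-characteristic if $T_pS\ne\mathcal H_p$. On the non-characteristic part let $\mathcal HTS=\mathcal H\cap TS$ (of rank $2n-1$), let $N$ be a local smooth Riemannian unit normal, and put $$N^{\mathbb H}=N-\langle N,T\rangle T,\qquad \nu=\frac{N^{\mathbb H}}{|N^{\mathbb H}|},\qquad \alpha=\frac{\langle N,T\rangle}{|N^{\mathbb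 H}|},\qquad \pi(X)=X-\langle X,\nu\rangle\nu .$$ Let $\Gamma(\mathcal HTS)$ be the smooth sections of $\mathcal HTS$. For $X,Y\in\Gamma(\mathcal HTS)$ set $\nabla^S_XY=\pi(\nabla_XY)$. For a horizontal $(p,0)$-tensor field $\tau$, i.e. a $C^\infty$-multilinear map $\Gamma(\mathcal HTS)^p\to C^\infty$, set $$(\nabla^S\tau)(X,X_1,\dots,X_p)=X\big(\tau(X_1,\dots,X_p)\big)-\sum_{i=1}^p\tau(X_1,\dots,\nabla^S_XX_i,\dots,X_p),$$ $$\mathrm{Hess}^{\mathcal H,S}\tau=\nabla^S(\nabla^S\tau),\qquad \Delta^{\mathcal H,S}\tau(X_1,\dots,X_p)=\sum_{j=1}^{2n-1}\mathrm{Hess}^{\mathcal H,S}\tau(E_j,E_j,X_1,\dots,X_p),$$ where $E_1,\dots,E_{2n-1}$ is any local smooth orthonormal frame of $\mathcal HTS$. For functions ($p=0$), $\mathrm{Hess}^{\mathcal H,S}f(X,Y)=X(Yf)-(\nabla^S_XY)f$. The horizontal second fundamental form and its symmetric counterpart are $$h(X,Y)=\langle\nabla_X\nu,Y\rangle,\qquad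 \tilde h(X,Y)=\langle\nabla_X\nu+\alpha J'(X),Y\rangle,\qquad J'(X)=J\big(X-\langle X,J(\nu)\rangle J(\nu)\big).$$ The hypersurface $S$ is minimal if $H=\sum_jh(E_j,E_j)$ vanishes on the non-characteristic part. The stability function is $$q=|\tilde h|^2+4\,J(\nu)\alpha+2(n+1)\alpha^2,\qquad |\tilde h|^2=\sum_{i,j}\tilde h(E_i,E_j)^2 .$$ **Theorem 1.1 (Simons formula).** Let $S$ be a smooth, immersed, minimal hypersurface in $\mathbb H^n$. Then, on the non-characteristic part of $S$ and for any local smooth unit normal $N$, for all $X,Y\in\Gamma(\mathcal HTS)$, $$\begin{aligned} \Delta^{\mathcal H,S}h(X,Y)={}&-q\,h(X,Y)+8\alpha^2h(X,Y)\\ &+4\,\mathrm{Hess}^{\mathcal H,S}\alpha(\pi(J(X)),Y)+4\,\mathrm{Hess}^{\mathcal H,S}\alpha(X,\pi(J(Y)))\\ &+\Big(16\,\alpha\,\pi(J(X))\alpha-8\alpha^2h(X,J(\nu))+4(\nabla_X\nu)\alpha\Big)\langle Y,J(\nu)\rangle\\ &-2\,(X\alpha)\,h(Y,J(\nu))-2\,(Y\alpha)\,h(X,J(\nu))\\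 &+2\alpha\,h(Y,\nabla_{\pi(J(X))}\nu)-2\alpha\,\langle\nabla_X\nabla_{J(\nu)}\nu,Y\rangle-4\alpha^2h(\pi(J(X)),\pi(J(Y)))\\ &+2\alpha\,\langle J(\nabla_X\nu),\nabla_Y\nu\rangle . \end{aligned}$$ Here $V\alpha$ denotes the derivative of $\alpha$ along the tangent field $V$. -/

import Mathlib

open scoped Manifold ContDiff

noncomputable section

namespace Heisenberg

/-! ### The Heisenberg group `ℍⁿ`, its left-invariant frame, metric, complex structure, connection -/

/-- The underlying manifold `ℝ^(2n+1)` of the `n`-th Heisenberg group, with points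
`q = (x, y, t)`.  Only its smooth structure is used; the Riemannian metric is the one that makes
the left-invariant frame `frame` orthonormal. -/
abbrev Heis (n : ℕ) : Type :=
  EuclideanSpace ℝ (Fin n) × EuclideanSpace ℝ (Fin n) × ℝ

/-- Labels of the left-invariant frame: `inl j` is `X_j`, `inr (inl j)` is `Y_j`,
`inr (inr ())` is `T`. -/
abbrev FrameIdx (n : ℕ) : Type := Fin n ⊕ Fin n ⊕ Unit

/-- Tangent vectors of `ℍⁿ`, written through their coefficients in the left-invariant frame:
`a : Vec n` stands at `q` for `∑ i, a i • Z_i(q)`.  As the frame is orthonormal, the Riemannian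
metric of `ℍⁿ` is the Euclidean inner product of the coefficients. -/
abbrev Vec (n : ℕ) : Type := EuclideanSpace ℝ (FrameIdx n)

/-- The left-invariant fields `X_j = ∂_{x_j} + y_j ∂_t`, `Y_j = ∂_{y_j} - x_j ∂_t`, `T = ∂_t`. -/
def frame {n : ℕ} (i : FrameIdx n) (q : Heis n) : Heis n :=
  match i with
  | Sum.inl j => (EuclideanSpace.single j 1, 0, q.2.1 j)
  | Sum.inr (Sum.inl j) => (0, EuclideanSpace.single j 1, -q.1 j)
  | Sum.inr (Sum.inr _) => (0, 0, 1)

/-- The tangent vector (in coordinates) with given frame coefficients. -/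
def ofFrame {n : ℕ} (q : Heis n) (a : Vec n) : Heis n :=
  ∑ i, a i • frame i q

/-- The frame coefficients of a tangent vector given in coordinates. -/
def coframe {n : ℕ} (q : Heis n) : Heis n →ₗ[ℝ] Vec n where
  toFun v := WithLp.toLp 2 (Sum.elim (fun j => v.1 j) (Sum.elim (fun j => v.2.1 j)
    (fun _ => v.2.2 - ∑ j, (q.2.1 j * v.1 j - q.1 j * v.2.1 j))))
  map_add' v w := by
    ext i
    rcases i with j | j | j
    · simp
    · simp
    · simp only [Prod.fst_add, Prod.snd_add, PiLp.add_apply, Sum.elim_inr]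
      rw [sub_add_sub_comm, ← Finset.sum_add_distrib]
      congr 1
      exact Finset.sum_congr rfl fun j _ => by ring
  map_smul' c v := by
    ext i
    rcases i with j | j | j
    · simp
    · simp
    · simp only [Prod.smul_fst, Prod.smul_snd, PiLp.smul_apply, Sum.elim_inr, smul_eq_mul,
        RingHom.id_apply]
      rw [mul_sub, Finset.mul_sum]
      congr 1
      exact Finset.sum_congr rfl fun j _ => by ring

theorem ofFrame_eq {n : ℕ} (q : Heis n) (a : Vec n) :
    ofFrame q a = (WithLp.toLp 2 (fun j => a (Sum.inl j)),
      WithLp.toLp 2 (fun j => a (Sum.inr (Sum.inl j))),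
      a (Sum.inr (Sum.inr ())) +
        ∑ j, (q.2.1 j * a (Sum.inl j) - q.1 j * a (Sum.inr (Sum.inl j)))) := by
  simp only [ofFrame, Fintype.sum_sum_type, frame, Finset.univ_unique, Finset.sum_singleton]
  refine Prod.ext ?_ (Prod.ext ?_ ?_)
  · ext k
    simp [Prod.fst_sum, Finset.sum_apply, Pi.single_apply]
  · ext k
    simp [Prod.fst_sum, Prod.snd_sum, Finset.sum_apply, Pi.single_apply]
  · simp only [Prod.snd_add, Prod.snd_sum, Prod.smul_snd, smul_eq_mul, Finset.sum_sub_distrib]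
    simp only [mul_neg, Finset.sum_neg_distrib, mul_comm]
    change _ + (_ + 1 * a (Sum.inr (Sum.inr ()))) = _
    ring

theorem coframe_ofFrame {n : ℕ} (q : Heis n) (a : Vec n) : coframe q (ofFrame q a) = a := by
  rw [ofFrame_eq]
  ext i
  rcases i with j | j | j <;> simp [coframe]

theorem ofFrame_coframe {n : ℕ} (q v : Heis n) : ofFrame q (coframe q v) = v := by
  rw [ofFrame_eq]
  refine Prod.ext ?_ (Prod.ext ?_ ?_)
  · ext k
    simp [coframe]
  · ext k
    simp [coframe]
  · simp [coframe]

/-- The vertical field `T`. -/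
def vertical (n : ℕ) : Vec n := EuclideanSpace.single (Sum.inr (Sum.inr ())) 1

/-- The horizontal distribution, spanned by the `X_j` and `Y_j`. -/
def horizontal (n : ℕ) : Submodule ℝ (Vec n) :=
  LinearMap.ker (EuclideanSpace.proj (Sum.inr (Sum.inr ())) : Vec n →L[ℝ] ℝ).toLinearMap

/-- The complex structure: `J X_j = Y_j`, `J Y_j = -X_j`, `J T = 0`. -/
def J {n : ℕ} (a : Vec n) : Vec n :=
  WithLp.toLp 2 (Sum.elim (fun j => -a (Sum.inr (Sum.inl j)))
    (Sum.elim (fun j => a (Sum.inl j)) (fun _ => 0)))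

/-- The pseudohermitian connection of `ℍⁿ`, on vector fields written in the left-invariant frame:
the metric connection for which the fields `Z_i` are parallel. -/
def pseudohermitian {n : ℕ} (A B : Heis n → Vec n) (q : Heis n) : Vec n :=
  fderiv ℝ B q (ofFrame q (A q))

/-- The connection is metric. -/
theorem pseudohermitian_metric {n : ℕ} (A B C : Heis n → Vec n) (q : Heis n)
    (hB : DifferentiableAt ℝ B q) (hC : DifferentiableAt ℝ C q) :
    fderiv ℝ (fun r => inner ℝ (B r) (C r)) q (ofFrame q (A q)) =
      inner ℝ (pseudohermitian A B q) (C q) + inner ℝ (B q) (pseudohermitian A C q) := by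
  rw [fderiv_inner_apply ℝ hB hC]
  simp only [pseudohermitian]
  ring

/-- The torsion of the connection is `2 ⟨J A, B⟩ T`; together with the previous fact this
characterizes it. -/
theorem pseudohermitian_torsion {n : ℕ} (A B : Heis n → Vec n) (q : Heis n)
    (hA : DifferentiableAt ℝ A q) (hB : DifferentiableAt ℝ B q) :
    pseudohermitian A B q - pseudohermitian B A q
      - coframe q (VectorField.lieBracket ℝ (fun r => ofFrame r (A r))
          (fun r => ofFrame r (B r)) q)
      = (2 * inner ℝ (J (A q)) (B q)) • vertical n := by
  have key : ∀ C : Heis n → Vec n, DifferentiableAt ℝ C q → ∀ w : Heis n,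
      fderiv ℝ (fun r => ofFrame r (C r)) q w = ofFrame q (fderiv ℝ C q w) +
        (0, 0, ∑ j, (w.2.1 j * C q (Sum.inl j) - w.1 j * C q (Sum.inr (Sum.inl j)))) := by
    intro C hC w
    have hc : ∀ i, HasFDerivAt (fun r => C r i)
        ((EuclideanSpace.proj i : Vec n →L[ℝ] ℝ).comp (fderiv ℝ C q)) q := fun i =>
      (EuclideanSpace.proj i : Vec n →L[ℝ] ℝ).hasFDerivAt.comp q hC.hasFDerivAt
    have hx : ∀ j, HasFDerivAt (fun r : Heis n => r.1 j)
        ((EuclideanSpace.proj j : EuclideanSpace ℝ (Fin n) →L[ℝ] ℝ).comp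
          (ContinuousLinearMap.fst ℝ _ _)) q := fun j =>
      (EuclideanSpace.proj j : EuclideanSpace ℝ (Fin n) →L[ℝ] ℝ).hasFDerivAt.comp q
        (hasFDerivAt_fst (𝕜 := ℝ) (p := q))
    have hy : ∀ j, HasFDerivAt (fun r : Heis n => r.2.1 j)
        ((EuclideanSpace.proj j : EuclideanSpace ℝ (Fin n) →L[ℝ] ℝ).comp
          ((ContinuousLinearMap.fst ℝ _ _).comp (ContinuousLinearMap.snd ℝ _ _))) q := fun j =>
      (EuclideanSpace.proj j : EuclideanSpace ℝ (Fin n) →L[ℝ] ℝ).hasFDerivAt.comp q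
        ((hasFDerivAt_fst (𝕜 := ℝ) (p := q.2)).comp q (hasFDerivAt_snd (𝕜 := ℝ) (p := q)))
    have h1 : HasFDerivAt (fun r : Heis n => (WithLp.toLp 2 (fun j => C r (Sum.inl j)) :
        EuclideanSpace ℝ (Fin n))) _ q :=
      (PiLp.hasFDerivAt_toLp 2 _).comp q (hasFDerivAt_pi.2 fun j => hc (Sum.inl j))
    have h2 : HasFDerivAt (fun r : Heis n =>
        (WithLp.toLp 2 (fun j => C r (Sum.inr (Sum.inl j))) : EuclideanSpace ℝ (Fin n))) _ q :=
      (PiLp.hasFDerivAt_toLp 2 _).comp q (hasFDerivAt_pi.2 fun j => hc (Sum.inr (Sum.inl j)))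
    have h3 := (hc (Sum.inr (Sum.inr ()))).add (HasFDerivAt.fun_sum (u := Finset.univ) fun j _ =>
      ((hy j).mul (hc (Sum.inl j))).sub ((hx j).mul (hc (Sum.inr (Sum.inl j)))))
    have h := (h1.prodMk (h2.prodMk h3)).fderiv
    have e : (fun r => ofFrame r (C r)) = fun r => _ := funext fun r => ofFrame_eq r (C r)
    rw [e]
    refine (congrArg (fun L => L w) h).trans ?_
    rw [ofFrame_eq]
    refine Prod.ext ?_ (Prod.ext ?_ ?_)
    · ext k
      simp
    · ext k
      simp
    · simp
      simp only [Finset.sum_add_distrib, mul_comm]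
      ring
  have hv : ∀ c : ℝ, coframe q (0, 0, c) = c • vertical n := by
    intro c
    ext i
    rcases i with j | j | j <;> simp [coframe, vertical]
  rw [VectorField.lieBracket, key B hB, key A hA]
  simp only [map_sub, map_add, coframe_ofFrame, hv, pseudohermitian]
  have hs : ∀ a b c d : Vec n, a - b - (a + c - (b + d)) = d - c := fun a b c d => by abel
  rw [hs, ← sub_smul]
  congr 1
  simp [ofFrame_eq, J, PiLp.inner_apply, Fintype.sum_sum_type]
  simp only [← Finset.sum_sub_distrib, ← Finset.sum_add_distrib, ← Finset.sum_neg_distrib,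
    Finset.mul_sum]
  exact Finset.sum_congr rfl fun j _ => by ring

/-! ### Immersed hypersurfaces -/

section Hypersurface

variable {n : ℕ} {M : Type*} [TopologicalSpace M] [ChartedSpace (EuclideanSpace ℝ (Fin (2 * n))) M]

/-- `F : M → ℍⁿ` is a smooth immersion of the `2n`-dimensional manifold `M` (without boundary). -/
structure IsImmersedHypersurface (F : M → Heis n) : Prop where
  smooth : ContMDiff (𝓡 (2 * n)) 𝓘(ℝ, Heis n) ∞ F
  injective : ∀ p, Function.Injective (mfderiv (𝓡 (2 * n)) 𝓘(ℝ, Heis n) F p)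

/-- The differential of `F` at `p`, in frame coefficients. -/
def frameDiff (F : M → Heis n) (p : M) : TangentSpace (𝓡 (2 * n)) p →ₗ[ℝ] Vec n :=
  (coframe (F p)).comp (mfderiv (𝓡 (2 * n)) 𝓘(ℝ, Heis n) F p).toLinearMap

/-- The tangent space of the hypersurface at `p`. -/
def tangent (F : M → Heis n) (p : M) : Submodule ℝ (Vec n) := LinearMap.range (frameDiff F p)

/-- The horizontal tangent space of the hypersurface at `p`. -/
def horTangent (F : M → Heis n) (p : M) : Submodule ℝ (Vec n) := horizontal n ⊓ tangent F p

/-- The non-characteristic part of the hypersurface. -/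
def nonChar (F : M → Heis n) : Set M := {p | tangent F p ≠ horizontal n}

/-- The vector of `T_p M` that `dF_p` maps to the tangent vector `v ∈ tangent F p`. -/
def lift (F : M → Heis n) (p : M) (v : Vec n) : TangentSpace (𝓡 (2 * n)) p :=
  Function.invFun (frameDiff F p) v

/-- The derivative `X f` of a function on the hypersurface along a tangent field `X`. -/
def dirDeriv (F : M → Heis n) (X : M → Vec n) (f : M → ℝ) (p : M) : ℝ :=
  mfderiv (𝓡 (2 * n)) 𝓘(ℝ, ℝ) f p (lift F p (X p))

/-- The covariant derivative `∇_X V`, for the pseudohermitian connection, of a vector field `V`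
of `ℍⁿ` along the hypersurface, in the direction of the tangent field `X`. -/
def cov (F : M → Heis n) (X V : M → Vec n) (p : M) : Vec n :=
  mfderiv (𝓡 (2 * n)) 𝓘(ℝ, Vec n) V p (lift F p (X p))

/-- `cov` is induced by the connection of `ℍⁿ`: for fields that come from ambient ones, it is the
ambient covariant derivative. -/
theorem cov_eq_pseudohermitian (F : M → Heis n) (A B : Heis n → Vec n) (p : M)
    (hF : MDifferentiableAt (𝓡 (2 * n)) 𝓘(ℝ, Heis n) F p)
    (hA : A (F p) ∈ tangent F p) (hB : DifferentiableAt ℝ B (F p)) :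
    cov F (A ∘ F) (B ∘ F) p = pseudohermitian A B (F p) := by
  have hl : frameDiff F p (lift F p (A (F p))) = A (F p) := Function.invFun_eq hA
  have hB' : MDifferentiableAt 𝓘(ℝ, Heis n) 𝓘(ℝ, Vec n) B (F p) := hB.mdifferentiableAt
  have hc : mfderiv (𝓡 (2 * n)) 𝓘(ℝ, Vec n) (B ∘ F) p (lift F p (A (F p))) =
      fderiv ℝ B (F p) (mfderiv (𝓡 (2 * n)) 𝓘(ℝ, Heis n) F p (lift F p (A (F p)))) := by
    rw [mfderiv_comp p hB' hF, mfderiv_eq_fderiv]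
    rfl
  refine hc.trans ?_
  have hw : mfderiv (𝓡 (2 * n)) 𝓘(ℝ, Heis n) F p (lift F p (A (F p))) =
      ofFrame (F p) (A (F p)) := by
    conv_rhs => rw [← hl]
    exact (ofFrame_coframe (F p) _).symm
  exact congrArg (fderiv ℝ B (F p)) hw

/-- `X` is a smooth section of the horizontal tangent distribution over `U`. -/
structure IsHorTangentField (F : M → Heis n) (U : Set M) (X : M → Vec n) : Prop where
  smooth : ContMDiffOn (𝓡 (2 * n)) 𝓘(ℝ, Vec n) ∞ X U
  mem : ∀ p ∈ U, X p ∈ horTangent F p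

/-- `N` is a smooth Riemannian unit normal of the hypersurface over `U`. -/
structure IsUnitNormal (F : M → Heis n) (U : Set M) (N : M → Vec n) : Prop where
  smooth : ContMDiffOn (𝓡 (2 * n)) 𝓘(ℝ, Vec n) ∞ N U
  norm_eq : ∀ p ∈ U, ‖N p‖ = 1
  orthogonal : ∀ p ∈ U, ∀ v ∈ tangent F p, inner ℝ (N p) v = 0

/-- `E` is a smooth orthonormal frame of the horizontal tangent distribution over `U`. -/
structure IsHorFrame (F : M → Heis n) (U : Set M) (E : Fin (2 * n - 1) → M → Vec n) : Prop where
  field : ∀ j, IsHorTangentField F U (E j)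
  orthonormal : ∀ p ∈ U, Orthonormal ℝ (fun j => E j p)

/-- The horizontal projection `N - ⟨N, T⟩ T` of the normal `N`. -/
def horNormal (N : M → Vec n) (p : M) : Vec n :=
  N p - (inner ℝ (N p) (vertical n) : ℝ) • vertical n

/-- The horizontal unit normal `ν`. -/
def nu (N : M → Vec n) (p : M) : Vec n := ‖horNormal N p‖⁻¹ • horNormal N p

/-- The fundamental function `α`. -/
def alpha (N : M → Vec n) (p : M) : ℝ := inner ℝ (N p) (vertical n) / ‖horNormal N p‖

/-- The field `J X`. -/
def JF (X : M → Vec n) (p : M) : Vec n := J (X p)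

/-- The projection `π(X) = X - ⟨X, ν⟩ ν`. -/
def proj (N X : M → Vec n) (p : M) : Vec n := X p - (inner ℝ (X p) (nu N p) : ℝ) • nu N p

/-- The tangent pseudohermitian connection `∇^S_X Y = ∇_X Y - ⟨∇_X Y, ν⟩ ν`. -/
def covS (F : M → Heis n) (N X Y : M → Vec n) : M → Vec n := proj N (cov F X Y)

/-- Horizontal `(p, 0)`-tensor fields, as functions of `p` vector fields. -/
abbrev HTensor (n : ℕ) (M : Type*) (p : ℕ) : Type _ := (Fin p → M → Vec n) → M → ℝ

/-- The covariant derivative of a tensor field: `(nablaS F N τ) (X, X₁, …, X_p)` is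
`X (τ (X₁, …, X_p)) - ∑ i, τ (X₁, …, ∇^S_X X_i, …, X_p)`. -/
def nablaS (F : M → Heis n) (N : M → Vec n) {p : ℕ} (τ : HTensor n M p) : HTensor n M (p + 1) :=
  fun X x => dirDeriv F (X 0) (τ (Fin.tail X)) x
    - ∑ i, τ (Function.update (Fin.tail X) i (covS F N (X 0) (Fin.tail X i))) x

/-- The horizontal tangential Hessian of a tensor field. -/
def hess (F : M → Heis n) (N : M → Vec n) {p : ℕ} (τ : HTensor n M p) : HTensor n M (p + 2) :=
  nablaS F N (nablaS F N τ)

/-- The horizontal tangential Laplacian of a tensor field: the trace of the Hessian in its first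
two arguments, in the orthonormal frame `E`. -/
def lap (F : M → Heis n) (N : M → Vec n) (E : Fin (2 * n - 1) → M → Vec n) {p : ℕ}
    (τ : HTensor n M p) : HTensor n M p :=
  fun X x => ∑ j, hess F N τ (Fin.cons (E j) (Fin.cons (E j) X)) x

/-- A function, as a `(0, 0)`-tensor field. -/
def ofFun (f : M → ℝ) : HTensor n M 0 := fun _ => f

/-- The horizontal second fundamental form `h(X, Y) = ⟨∇_X ν, Y⟩`. -/
def sff (F : M → Heis n) (N : M → Vec n) : HTensor n M 2 :=
  fun X x => inner ℝ (cov F (X 0) (nu N) x) (X 1 x)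

/-- The map `J'` on horizontal tangent fields: `J' = J` on the `J`-invariant part of the
distribution, and `J' (J ν) = 0`. -/
def JPrime (N X : M → Vec n) (p : M) : Vec n :=
  J (X p - (inner ℝ (X p) (J (nu N p)) : ℝ) • J (nu N p))

/-- The symmetric horizontal second fundamental form `h̃(X, Y) = ⟨∇_X ν + α J'(X), Y⟩`. -/
def symSff (F : M → Heis n) (N : M → Vec n) : HTensor n M 2 :=
  fun X x => inner ℝ (cov F (X 0) (nu N) x + alpha N x • JPrime N (X 0) x) (X 1 x)

/-- The horizontal mean curvature `H`, the trace of `h` in the orthonormal frame `E`. -/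
def meanCurv (F : M → Heis n) (N : M → Vec n) (E : Fin (2 * n - 1) → M → Vec n) (x : M) : ℝ :=
  ∑ j, sff F N ![E j, E j] x

/-- The stability function `q = |h̃|² + 4 ⟨∇α, J ν⟩ + 2 (n + 1) α²`. -/
def stability (F : M → Heis n) (N : M → Vec n) (E : Fin (2 * n - 1) → M → Vec n) (x : M) : ℝ :=
  (∑ i, ∑ j, symSff F N ![E i, E j] x ^ 2) + 4 * dirDeriv F (JF (nu N)) (alpha N) x
    + 2 * (n + 1) * alpha N x ^ 2

/-- The hypersurface is minimal: `H` vanishes on its non-characteristic part (for every local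
choice of the unit normal and of the orthonormal frame). -/
def IsMinimal (F : M → Heis n) : Prop :=
  ∀ U : Set M, IsOpen U → U ⊆ nonChar F → ∀ N : M → Vec n, IsUnitNormal F U N →
    ∀ E : Fin (2 * n - 1) → M → Vec n, IsHorFrame F U E → ∀ x ∈ U, meanCurv F N E x = 0

end Hypersurface

end Heisenberg

end

open Heisenberg

/-- The tensor calculus on the module `L` of horizontal tangent fields of a hypersurface of the
Heisenberg group, over the ring `R` of functions: `g` is the metric, `D` the derivation of
functions, `nab` the tangential connection, `A X = ∇_X ν` the shape operator, `P = π ∘ J`,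
`u = J ν`, and `nabs` the derivative in the transverse direction `T - α ν`.
The fields are the structure equations. -/
structure HorizontalCalculus (R L : Type*) [CommRing R] [AddCommGroup L] [Module R L] (m : ℕ) where
  g : L →ₗ[R] L →ₗ[R] R
  D : L →ₗ[R] Derivation ℤ R R
  nab : L →ₗ[R] L →+ L
  nabs : L →+ L
  A : L →ₗ[R] L
  P : L →ₗ[R] L
  u : L
  a : L
  α : R
  e : Fin m → L
  g_comm : ∀ X Y, g X Y = g Y X
  nab_smul : ∀ X f Y, nab X (f • Y) = D X f • Y + f • nab X Y
  metric : ∀ X Y Z, D X (g Y Z) = g (nab X Y) Z + g Y (nab X Z)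
  expand : ∀ X, X = ∑ j, g X (e j) • e j
  orthonormal : ∀ i j, g (e i) (e j) = if i = j then 1 else 0
  P_skew : ∀ X Y, g (P X) Y = - g X (P Y)
  P_u : P u = 0
  P_P : ∀ X, P (P X) = - X + g u X • u
  u_u : g u u = 1
  nab_P : ∀ X Y, nab X (P Y) = P (nab X Y) - g (A X) Y • u + g u Y • A X
  nab_u : ∀ X, nab X u = P (A X)
  A_swap : ∀ X Y, g (A Y) X = g (A X) Y + 2 * α * g (P X) Y
  g_a : ∀ X, g a X = D X α + 2 * α ^ 2 * g u X
  codazzi : ∀ X Y, nab X (A Y) - A (nab X Y) = nab Y (A X) - A (nab Y X) - (2 * g (P X) Y) • a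
  curvature : ∀ X Y Z, nab X (nab Y Z) - nab Y (nab X Z) =
    nab (nab X Y) Z - nab (nab Y X) Z - (2 * g (P X) Y) • nabs Z + g (A Y) Z • A X - g (A X) Z • A Y
  transverse : ∀ X, nabs (A X) - A (nabs X) = nab X a + α • A (A X) + (2 * α * g u X) • a
  trace_A : ∑ j, g (A (e j)) (e j) = 0

namespace HorizontalCalculus

variable {R L : Type*} [CommRing R] [AddCommGroup L] [Module R L] {m : ℕ}
  (K : HorizontalCalculus R L m)

/-- The covariant derivative of the shape operator. -/
def nabA (Z X : L) : L := K.nab Z (K.A X) - K.A (K.nab Z X)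

/-- The second covariant derivative of the shape operator. -/
def nabnabA (W Z X : L) : L :=
  K.nab W (K.nabA Z X) - K.nabA (K.nab W Z) X - K.nabA Z (K.nab W X)

/-- The covariant derivative of the second fundamental form. -/
def nabh (Z X Y : L) : R :=
  K.D Z (K.g (K.A X) Y) - (K.g (K.A (K.nab Z X)) Y + K.g (K.A X) (K.nab Z Y))

/-- The second covariant derivative of the second fundamental form. -/
def nabnabh (W Z X Y : L) : R :=
  K.D W (K.nabh Z X Y) - (K.nabh (K.nab W Z) X Y + K.nabh Z (K.nab W X) Y
    + K.nabh Z X (K.nab W Y))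

/-- The Hessian of a function. -/
def hessFun (f : R) (X Y : L) : R := K.D X (K.D Y f) - K.D (K.nab X Y) f

theorem nabh_eq (Z X Y : L) : K.nabh Z X Y = K.g (K.nabA Z X) Y := by
  simp only [nabh, nabA, K.metric, map_sub, LinearMap.sub_apply]
  ring

theorem nabnabh_eq (W Z X Y : L) : K.nabnabh W Z X Y = K.g (K.nabnabA W Z X) Y := by
  simp only [nabnabh, nabnabA, nabh_eq, K.metric, map_sub, LinearMap.sub_apply]
  ring

theorem sum_g_mul_g (X Y : L) : ∑ j, K.g X (K.e j) * K.g (K.e j) Y = K.g X Y := by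
  conv_rhs => rw [K.expand X]
  simp [map_sum, LinearMap.sum_apply]

theorem sum_g_mul_apply (f : L →ₗ[R] R) (X : L) : ∑ j, K.g X (K.e j) * f (K.e j) = f X := by
  conv_rhs => rw [K.expand X]
  simp [map_sum]

/-- Traces commute with covariant differentiation. -/
theorem trace_nab_eq_zero (b : L →ₗ[R] L →ₗ[R] R) (X : L) :
    ∑ j, (b (K.nab X (K.e j)) (K.e j) + b (K.e j) (K.nab X (K.e j))) = 0 := by
  have hskew : ∀ j k, K.g (K.nab X (K.e j)) (K.e k) = - K.g (K.nab X (K.e k)) (K.e j) := by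
    intro j k
    have h := K.metric X (K.e j) (K.e k)
    rw [K.orthonormal, K.g_comm (K.e j)] at h
    have h0 : K.D X (if j = k then 1 else 0) = 0 := by split_ifs <;> simp
    rw [h0] at h
    linear_combination -h
  have h1 : ∀ j, b (K.nab X (K.e j)) (K.e j) =
      ∑ k, K.g (K.nab X (K.e j)) (K.e k) * b (K.e k) (K.e j) := by
    intro j
    conv_lhs => rw [K.expand (K.nab X (K.e j))]
    simp [map_sum, LinearMap.sum_apply]
  have h2 : ∀ j, b (K.e j) (K.nab X (K.e j)) =
      ∑ k, K.g (K.nab X (K.e j)) (K.e k) * b (K.e j) (K.e k) := by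
    intro j
    conv_lhs => rw [K.expand (K.nab X (K.e j))]
    simp [map_sum]
  simp only [h1, h2, Finset.sum_add_distrib]
  rw [Finset.sum_comm, ← Finset.sum_add_distrib]
  refine Finset.sum_eq_zero fun j _ => ?_
  rw [← Finset.sum_add_distrib]
  refine Finset.sum_eq_zero fun k _ => ?_
  rw [hskew k j]
  ring

theorem nabA_swap (Z X : L) : K.nabA Z X = K.nabA X Z - (2 * K.g (K.P Z) X) • K.a :=
  K.codazzi Z X

theorem D_two_mul (X : L) (f : R) : K.D X (2 * f) = 2 * K.D X f := by
  rw [two_mul, map_add, two_mul]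

theorem nab_P_form (W Z X : L) : K.D W (K.g (K.P Z) X) - K.g (K.P (K.nab W Z)) X
    - K.g (K.P Z) (K.nab W X) = - K.g (K.A W) Z * K.g K.u X + K.g K.u Z * K.g (K.A W) X := by
  rw [K.metric, K.nab_P]
  simp only [map_add, map_sub, LinearMap.sub_apply, LinearMap.add_apply, map_smul,
    LinearMap.smul_apply, smul_eq_mul]
  ring

theorem nabnabA_swap (W Z X : L) : K.nabnabA W Z X = K.nabnabA W X Z
    - (2 * (- K.g (K.A W) Z * K.g K.u X + K.g K.u Z * K.g (K.A W) X)) • K.a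
    - (2 * K.g (K.P Z) X) • K.nab W K.a := by
  rw [← K.nab_P_form]
  simp only [nabnabA]
  rw [K.nabA_swap Z X, K.nabA_swap (K.nab W Z) X, K.nabA_swap Z (K.nab W X), map_sub,
    K.nab_smul, K.D_two_mul]
  module

theorem nabnabA_comm (W X Z : L) : K.nabnabA W X Z = K.nabnabA X W Z
    + K.g (K.A X) (K.A Z) • K.A W - K.g (K.A W) (K.A Z) • K.A X
    - K.A (K.g (K.A X) Z • K.A W - K.g (K.A W) Z • K.A X)
    - (2 * K.g (K.P W) X) • (K.nab Z K.a + K.α • K.A (K.A Z) + (2 * K.α * K.g K.u Z) • K.a) := by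
  rw [← K.transverse]
  have h1 := K.curvature W X (K.A Z)
  have h2 := congrArg K.A (K.curvature W X Z)
  simp only [map_add, map_sub, map_smul] at h2 ⊢
  simp only [nabnabA, nabA, map_sub]
  rw [← sub_eq_zero] at h1 h2 ⊢
  linear_combination (norm := module) h1 - h2

/-- The map `Z ↦ ∇_Z X`. -/
def nabHom (X : L) : L →ₗ[R] L where
  toFun Z := K.nab Z X
  map_add' Z W := by rw [map_add, AddMonoidHom.add_apply]
  map_smul' c Z := by rw [map_smul, AddMonoidHom.smul_apply, RingHom.id_apply]

/-- The bilinear form `(Z, X) ↦ (∇_Z h)(X, Y)`. -/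
def nabhForm (Y : L) : L →ₗ[R] L →ₗ[R] R :=
  LinearMap.mk₂ R (fun Z X => K.g (K.nabA Z X) Y)
    (by intro a b c; simp [nabA]; ring)
    (by intro c a b; simp [nabA]; ring)
    (by intro a b c; simp [nabA]; ring)
    (by intro c a b; simp [nabA, K.nab_smul]; ring)

theorem sum_g_mul_D (X : L) (f : R) : ∑ j, K.g X (K.e j) * K.D (K.e j) f = K.D X f :=
  K.sum_g_mul_apply
    { toFun := fun X => K.D X f
      map_add' := fun X Y => by rw [map_add, Derivation.add_apply]
      map_smul' := fun c X => by rw [map_smul, Derivation.smul_apply, RingHom.id_apply] } X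

theorem nabA_transpose (Z X Y : L) : K.g (K.nabA Z Y) X = K.g (K.nabA Z X) Y
    + 2 * K.D Z K.α * K.g (K.P X) Y
    + 2 * K.α * (- K.g (K.A Z) X * K.g K.u Y + K.g K.u X * K.g (K.A Z) Y) := by
  have h1 := congrArg (K.D Z) (K.A_swap X Y)
  have h2 := K.A_swap (K.nab Z X) Y
  have h3 := K.A_swap X (K.nab Z Y)
  have h4 : K.D Z (2 * K.α * K.g (K.P X) Y) = 2 * K.D Z K.α * K.g (K.P X) Y
      + 2 * K.α * K.D Z (K.g (K.P X) Y) := by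
    rw [Derivation.leibniz, K.D_two_mul, smul_eq_mul, smul_eq_mul]
    ring
  have h5 := K.nab_P_form Z X Y
  rw [map_add, h4] at h1
  simp only [K.metric] at h1 h5
  simp only [nabA, map_sub, LinearMap.sub_apply]
  linear_combination h1 - h2 - h3 + 2 * K.α * h5

theorem trace_nabA (Y : L) : ∑ j, K.g (K.nabA Y (K.e j)) (K.e j) = 0 := by
  have h := K.trace_nab_eq_zero (K.g ∘ₗ K.A) Y
  have h0 := congrArg (K.D Y) K.trace_A
  rw [map_sum, map_zero] at h0
  simp only [K.metric] at h0
  refine Eq.trans ?_ (sub_eq_zero.2 (h0.trans h.symm))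
  rw [← Finset.sum_sub_distrib]
  refine Finset.sum_congr rfl fun j _ => ?_
  simp only [nabA, map_sub, LinearMap.sub_apply, LinearMap.comp_apply]
  ring

theorem trace_nabh (Y : L) :
    ∑ j, K.g (K.nabA (K.e j) (K.e j)) Y = 4 * K.D (K.P Y) K.α - 2 * K.α * K.g (K.A K.u) Y := by
  have h1 : ∀ j, K.g (K.nabA (K.e j) (K.e j)) Y = K.g (K.nabA Y (K.e j)) (K.e j)
      + 2 * (K.g (K.P Y) (K.e j) * K.g (K.e j) K.a)
      + 2 * (K.g (K.P Y) (K.e j) * K.D (K.e j) K.α)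
      + 2 * K.α * K.g K.u Y * K.g (K.A (K.e j)) (K.e j)
      - 2 * K.α * (K.g K.u (K.e j) * (K.g.flip Y ∘ₗ K.A) (K.e j)) := by
    intro j
    have h2 := K.nabA_transpose (K.e j) (K.e j) Y
    have h3 := congrArg (fun v => K.g v (K.e j)) (K.nabA_swap (K.e j) Y)
    simp only [map_sub, LinearMap.sub_apply, map_smul, LinearMap.smul_apply, smul_eq_mul] at h3
    have h4 : K.g (K.P (K.e j)) Y = - K.g (K.P Y) (K.e j) := by
      rw [K.P_skew, K.g_comm]
    rw [h4] at h2 h3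
    rw [K.g_comm K.a] at h3
    simp only [LinearMap.comp_apply, LinearMap.flip_apply]
    linear_combination -h2 + h3
  simp only [h1, Finset.sum_add_distrib, Finset.sum_sub_distrib, ← Finset.mul_sum, K.trace_A,
    K.trace_nabA, K.sum_g_mul_g, K.sum_g_mul_D, sum_g_mul_apply]
  have h5 : K.g K.u (K.P Y) = 0 := by
    rw [← neg_eq_zero, ← K.P_skew, K.P_u, map_zero, LinearMap.zero_apply]
  rw [K.g_comm, K.g_a, h5]
  simp
  ring

theorem trace_nabnabA (X Y : L) :
    ∑ j, K.g (K.nabnabA X (K.e j) (K.e j)) Y =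
      4 * K.hessFun K.α X (K.P Y)
        + 4 * (- K.g (K.A X) Y * K.D K.u K.α + K.g K.u Y * K.D (K.A X) K.α)
      - 2 * K.D X K.α * K.g (K.A K.u) Y - 2 * K.α * K.g (K.nab X (K.A K.u)) Y := by
  have h := K.trace_nab_eq_zero (K.nabhForm Y) X
  simp only [nabhForm, LinearMap.mk₂_apply] at h
  have h1 : ∀ j, K.g (K.nabnabA X (K.e j) (K.e j)) Y =
      K.D X (K.g (K.nabA (K.e j) (K.e j)) Y) - K.g (K.nabA (K.e j) (K.e j)) (K.nab X Y)
      - (K.g (K.nabA (K.nab X (K.e j)) (K.e j)) Y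
        + K.g (K.nabA (K.e j) (K.nab X (K.e j))) Y) := by
    intro j
    simp only [nabnabA, K.metric, map_sub, LinearMap.sub_apply]
    ring
  simp only [h1, Finset.sum_sub_distrib, h, K.trace_nabh, ← map_sum]
  have h2 : K.D X (4 * K.D (K.P Y) K.α - 2 * K.α * K.g (K.A K.u) Y) =
      4 * K.D X (K.D (K.P Y) K.α) - 2 * K.D X K.α * K.g (K.A K.u) Y
      - 2 * K.α * K.D X (K.g (K.A K.u) Y) := by
    have e2 : K.D X 2 = 0 := by exact_mod_cast (K.D X).map_natCast 2
    have e4 : K.D X 4 = 0 := by exact_mod_cast (K.D X).map_natCast 4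
    simp only [map_sub, Derivation.leibniz, e2, e4, smul_eq_mul]
    ring
  rw [h2, K.metric, hessFun, K.nab_P]
  simp only [map_sub, map_add, map_smul, Derivation.sub_apply, Derivation.add_apply,
    Derivation.smul_apply, smul_eq_mul]
  ring

theorem g_nab_a (Z Y : L) : K.g (K.nab Z K.a) Y = K.hessFun K.α Z Y
    + 4 * K.α * K.D Z K.α * K.g K.u Y + 2 * K.α ^ 2 * K.g (K.P (K.A Z)) Y := by
  have h := K.metric Z K.a Y
  have h1 := K.metric Z K.u Y
  have e2 : K.D Z 2 = 0 := by exact_mod_cast (K.D Z).map_natCast 2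
  rw [K.nab_u] at h1
  simp only [K.g_a, map_add, pow_two, Derivation.leibniz, e2, h1, smul_eq_mul] at h
  rw [hessFun]
  linear_combination -h

theorem g_P_P (X Y : L) : K.g (K.P X) (K.P Y) = K.g X Y - K.g K.u X * K.g K.u Y := by
  have h := K.P_skew X (K.P Y)
  rw [h, K.P_P, map_add, map_neg, map_smul, smul_eq_mul, K.g_comm X K.u]
  ring

theorem sum_sq_symm : ∑ i, ∑ j, K.g (K.A (K.e i) + K.α • K.P (K.e i)) (K.e j) ^ 2 =
    (∑ i, K.g (K.A (K.e i)) (K.A (K.e i))) - (m - 1) * K.α ^ 2 := by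
  have h1 : ∑ i, K.g (K.P (K.e i)) (K.P (K.e i)) = m - 1 := by
    have h : ∑ i, K.g K.u (K.e i) * K.g K.u (K.e i) = 1 := by
      rw [← K.u_u, K.sum_g_mul_apply]
    simp only [K.g_P_P, Finset.sum_sub_distrib, h, K.orthonormal]
    simp
  have h2 : 2 * ∑ i, K.g (K.A (K.e i)) (K.P (K.e i)) = - 2 * K.α * (m - 1) := by
    have e1 : ∑ i, K.g (K.A (K.e i)) (K.P (K.e i)) =
        ∑ i, ∑ j, K.g (K.A (K.e i)) (K.e j) * K.g (K.P (K.e i)) (K.e j) := by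
      refine Finset.sum_congr rfl fun i _ => ?_
      rw [← K.sum_g_mul_g]
      exact Finset.sum_congr rfl fun j _ => by rw [K.g_comm (K.e j)]
    have e2 := e1
    rw [Finset.sum_comm] at e2
    rw [two_mul]
    refine (congrArg₂ (· + ·) e1 e2).trans ?_
    rw [← h1, ← Finset.sum_add_distrib, Finset.mul_sum]
    refine Finset.sum_congr rfl fun i _ => ?_
    rw [← Finset.sum_add_distrib, ← K.sum_g_mul_g, Finset.mul_sum]
    refine Finset.sum_congr rfl fun j _ => ?_
    have h3 := K.A_swap (K.e i) (K.e j)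
    have h4 : K.g (K.P (K.e j)) (K.e i) = - K.g (K.P (K.e i)) (K.e j) := by
      rw [K.P_skew, K.g_comm]
    rw [K.g_comm (K.e j), h4, h3]
    ring
  have h3 : ∀ v, ∑ j, K.g v (K.e j) ^ 2 = K.g v v := fun v => by
    rw [← K.sum_g_mul_g v v]
    exact Finset.sum_congr rfl fun j _ => by rw [K.g_comm (K.e j), pow_two]
  have h4 : ∀ i, K.g (K.A (K.e i) + K.α • K.P (K.e i)) (K.A (K.e i) + K.α • K.P (K.e i)) =
      K.g (K.A (K.e i)) (K.A (K.e i)) + K.α * (2 * K.g (K.A (K.e i)) (K.P (K.e i)))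
      + K.α ^ 2 * K.g (K.P (K.e i)) (K.P (K.e i)) := fun i => by
    simp only [map_add, map_smul, LinearMap.add_apply, LinearMap.smul_apply, smul_eq_mul]
    rw [K.g_comm (K.P (K.e i)) (K.A (K.e i))]
    ring
  simp only [h3, h4, Finset.sum_add_distrib, ← Finset.mul_sum, h1, h2]
  ring

/-- Simons' formula. -/
theorem simons (X Y : L) : ∑ j, K.nabnabh (K.e j) (K.e j) X Y =
    -((∑ i, ∑ j, K.g (K.A (K.e i) + K.α • K.P (K.e i)) (K.e j) ^ 2) + 4 * K.D K.u K.α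
        + (m + 3) * K.α ^ 2) * K.g (K.A X) Y
      + 8 * K.α ^ 2 * K.g (K.A X) Y
      + 4 * K.hessFun K.α (K.P X) Y + 4 * K.hessFun K.α X (K.P Y)
      + (16 * K.α * K.D (K.P X) K.α - 8 * K.α ^ 2 * K.g (K.A X) K.u + 4 * K.D (K.A X) K.α)
          * K.g Y K.u
      - 2 * K.D X K.α * K.g (K.A Y) K.u - 2 * K.D Y K.α * K.g (K.A X) K.u
      + 2 * K.α * K.g (K.A Y) (K.A (K.P X)) - 2 * K.α * K.g (K.nab X (K.A K.u)) Y
      - 4 * K.α ^ 2 * K.g (K.A (K.P X)) (K.P Y)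
      + 2 * K.α * K.g (K.P (K.A X)) (K.A Y) := by
  have hswap : ∀ j, K.g (K.A (K.e j)) Y = K.g (K.A Y + (2 * K.α) • K.P Y) (K.e j) := by
    intro j
    rw [K.A_swap Y]
    simp
  have h1 : ∀ j, K.nabnabh (K.e j) (K.e j) X Y = K.g (K.nabnabA X (K.e j) (K.e j)) Y
      + K.g (K.A Y + (2 * K.α) • K.P Y) (K.e j) * (K.g (K.A X) ∘ₗ K.A) (K.e j)
      - K.g (K.A (K.e j)) (K.A (K.e j)) * K.g (K.A X) Y
      - K.g (K.A X) (K.e j) * (K.g.flip Y ∘ₗ K.A ∘ₗ K.A) (K.e j)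
      + K.g (K.A (K.e j)) (K.e j) * K.g (K.A (K.A X)) Y
      + K.g (K.A (K.e j)) (K.e j) * (2 * K.g K.u X * K.g K.a Y)
      - 2 * (K.g K.u (K.e j) * (K.g.flip X ∘ₗ K.A) (K.e j)) * K.g K.a Y
      + 4 * (K.g (K.P X) (K.e j) * (K.g.flip Y ∘ₗ K.nabHom K.a) (K.e j))
      + 2 * K.α * (K.g (K.P X) (K.e j) * (K.g.flip Y ∘ₗ K.A ∘ₗ K.A) (K.e j))
      + 4 * K.α * (K.g (K.P X) (K.e j) * K.g (K.e j) K.u) * K.g K.a Y := by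
    intro j
    have h4 : K.g (K.P (K.e j)) X = - K.g (K.P X) (K.e j) := by
      rw [K.P_skew, K.g_comm]
    rw [← hswap, K.nabnabh_eq, K.nabnabA_swap, K.nabnabA_comm, h4, K.g_comm (K.e j) K.u]
    simp only [map_add, map_sub, map_smul, LinearMap.add_apply, LinearMap.sub_apply,
      LinearMap.smul_apply, smul_eq_mul, LinearMap.comp_apply, LinearMap.flip_apply, nabHom,
      LinearMap.coe_mk, AddHom.coe_mk]
    ring
  have hPu : ∀ Z, K.g (K.P Z) K.u = 0 := fun Z => by rw [K.P_skew, K.P_u, map_zero, neg_zero]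
  simp only [h1, Finset.sum_add_distrib, Finset.sum_sub_distrib, ← Finset.mul_sum,
    ← Finset.sum_mul, K.trace_A, K.sum_g_mul_apply, K.sum_g_mul_g, K.trace_nabnabA, K.sum_sq_symm,
    hPu]
  simp only [LinearMap.comp_apply, LinearMap.flip_apply, nabHom, LinearMap.coe_mk, AddHom.coe_mk,
    K.g_nab_a, K.g_a]
  have e1 : K.g (K.A X) (K.A (K.A Y + (2 * K.α) • K.P Y)) = K.g (K.A (K.A (K.A X))) Y
      + 2 * K.α * K.g (K.P (K.A X)) (K.A Y)
      + 4 * K.α ^ 2 * (K.g (K.A X) Y - K.g K.u (K.A X) * K.g K.u Y) := by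
    have h2 := K.A_swap (K.A X) (K.A Y + (2 * K.α) • K.P Y)
    have h3 := K.A_swap Y (K.A (K.A X))
    have h5 := K.g_P_P (K.A X) Y
    rw [K.g_comm (K.A X), h2, h3]
    simp only [map_add, map_smul, smul_eq_mul]
    rw [K.g_comm (K.A Y), K.g_comm (K.P Y)]
    linear_combination 4 * K.α ^ 2 * h5
  have e2 : K.g (K.A (K.A (K.P X))) Y = K.g (K.A Y) (K.A (K.P X))
      - 2 * K.α * K.g (K.P (K.A (K.P X))) Y := by
    have h2 := K.A_swap (K.A (K.P X)) Y
    linear_combination -h2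
  have e3 := K.P_skew (K.A (K.P X)) Y
  have e4 : K.g (K.A K.u) X = K.g (K.A X) K.u := by
    rw [K.A_swap X, hPu]
    ring
  have e5 : K.g (K.A K.u) Y = K.g (K.A Y) K.u := by
    rw [K.A_swap Y, hPu]
    ring
  rw [e1, e2, e3, e4, e5, K.g_comm Y K.u, K.g_comm (K.A X) K.u]
  ring

end HorizontalCalculus

namespace FrameField

variable {n : ℕ} {R : Type*} [CommRing R]

/-- The inner product of two vector fields given by their frame coefficients. -/
def ip : (FrameIdx n → R) →ₗ[R] (FrameIdx n → R) →ₗ[R] R :=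
  LinearMap.mk₂ R (fun A B => ∑ i, A i * B i)
    (fun A B C => by simp [add_mul, Finset.sum_add_distrib])
    (fun c A B => by simp only [Finset.mul_sum, Pi.smul_apply, smul_eq_mul, mul_assoc])
    (fun A B C => by simp [mul_add, Finset.sum_add_distrib])
    (fun c A B => by simp only [Finset.mul_sum, Pi.smul_apply, smul_eq_mul, mul_left_comm])

/-- The vertical field. -/
def vert : FrameIdx n → R := Pi.single (Sum.inr (Sum.inr ())) 1

/-- The complex structure on vector fields. -/
def cplx : (FrameIdx n → R) →ₗ[R] (FrameIdx n → R) where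
  toFun A := Sum.elim (fun j => -A (Sum.inr (Sum.inl j)))
    (Sum.elim (fun j => A (Sum.inl j)) (fun _ => 0))
  map_add' A B := by ext (j | j | j) <;> simp [add_comm]
  map_smul' c A := by ext (j | j | j) <;> simp

theorem ip_apply (A B : FrameIdx n → R) : ip A B = ∑ i, A i * B i := rfl

theorem ip_comm (A B : FrameIdx n → R) : ip A B = ip B A := by
  simp only [ip_apply, mul_comm]

theorem ip_vert (A : FrameIdx n → R) : ip A vert = A (Sum.inr (Sum.inr ())) := by
  simp [ip_apply, vert, Pi.single_apply]

theorem ip_cplx (A B : FrameIdx n → R) : ip (cplx A) B = - ip A (cplx B) := by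
  simp [ip_apply, cplx, Fintype.sum_sum_type, add_comm]

theorem cplx_vert_coeff (A : FrameIdx n → R) : cplx A (Sum.inr (Sum.inr ())) = 0 := rfl

theorem cplx_cplx (A : FrameIdx n → R) : cplx (cplx A) = - A + ip A vert • vert := by
  rw [ip_vert]
  ext (j | j | j) <;> simp [cplx, vert]

variable (D : (FrameIdx n → R) →ₗ[R] Derivation ℤ R R)

/-- The connection for which the frame is parallel. -/
def conn : (FrameIdx n → R) →ₗ[R] (FrameIdx n → R) →+ (FrameIdx n → R) where
  toFun X :=
    { toFun := fun A i => D X (A i)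
      map_zero' := by ext i; simp
      map_add' := fun A B => by ext i; simp }
  map_add' X Y := by ext A i; simp
  map_smul' c X := by ext A i; simp

theorem conn_apply (X A : FrameIdx n → R) (i : FrameIdx n) : conn D X A i = D X (A i) := rfl

theorem conn_smul (X : FrameIdx n → R) (f : R) (A : FrameIdx n → R) :
    conn D X (f • A) = D X f • A + f • conn D X A := by
  ext i
  simp [conn_apply]
  ring

theorem conn_ip (X A B : FrameIdx n → R) :
    D X (ip A B) = ip (conn D X A) B + ip A (conn D X B) := by
  simp only [ip_apply, map_sum, Derivation.leibniz, conn_apply, smul_eq_mul,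
    ← Finset.sum_add_distrib]
  exact Finset.sum_congr rfl fun i _ => by ring

theorem conn_vert (X : FrameIdx n → R) : conn D X vert = 0 := by
  ext i
  rcases eq_or_ne i (Sum.inr (Sum.inr ())) with rfl | h
  · simp [conn_apply, vert]
  · simp [conn_apply, vert, h]

theorem conn_cplx (X A : FrameIdx n → R) : conn D X (cplx A) = cplx (conn D X A) := by
  ext (j | j | j) <;> simp [conn_apply, cplx]

theorem ip_conn_vert (X A : FrameIdx n → R) : ip (conn D X A) vert = D X (ip A vert) := by
  rw [conn_ip, conn_vert, map_zero, add_zero]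

/-- The Lie bracket of two vector fields, computed from the torsion of the connection. -/
def bracket (X Y : FrameIdx n → R) : FrameIdx n → R :=
  conn D X Y - conn D Y X - (2 * ip (cplx X) Y) • vert

theorem bracket_apply (X Y : FrameIdx n → R) (i : FrameIdx n) :
    bracket D X Y i = D X (Y i) - D Y (X i) - 2 * ip (cplx X) Y * vert (R := R) i := rfl

/-- The horizontal tangent fields of a hypersurface with horizontal normal `ν`. -/
def horFields (ν : FrameIdx n → R) : Submodule R (FrameIdx n → R) :=
  LinearMap.ker (ip ν) ⊓ LinearMap.ker (ip vert)

/-- A hypersurface, described by its horizontal unit normal `ν` and the function `α` (so that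
`ν + α T` is normal), the derivations `D` along its tangent fields, and an orthonormal frame `E` of
its horizontal tangent fields. -/
structure IsHypersurface {m : ℕ} (ν : FrameIdx n → R) (α : R) (E : Fin m → FrameIdx n → R) :
    Prop where
  two_torsion : ∀ r : R, 2 * r = 0 → r = 0
  nu_nu : ip ν ν = 1
  nu_vert : ip ν vert = 0
  commutator : ∀ X Y, ip X (ν + α • vert) = 0 → ip Y (ν + α • vert) = 0 → ∀ f,
    D X (D Y f) - D Y (D X f) = D (bracket D X Y) f
  bracket_tangent : ∀ X Y, ip X (ν + α • vert) = 0 → ip Y (ν + α • vert) = 0 →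
    ip (bracket D X Y) (ν + α • vert) = 0
  frame_mem : ∀ j, E j ∈ horFields ν
  expand : ∀ X ∈ horFields ν, X = ∑ j, ip X (E j) • E j
  orthonormal : ∀ i j, ip (E i) (E j) = if i = j then 1 else 0

/-- The projection orthogonal to `ν`. -/
def orth (ν : FrameIdx n → R) : (FrameIdx n → R) →ₗ[R] (FrameIdx n → R) where
  toFun X := X - ip X ν • ν
  map_add' X Y := by simp only [map_add, LinearMap.add_apply]; module
  map_smul' c X := by
    simp only [map_smul, LinearMap.smul_apply, RingHom.id_apply, smul_eq_mul]; module

/-- The field `T - α ν`, tangent to the hypersurface. -/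
def transversal (ν : FrameIdx n → R) (α : R) : FrameIdx n → R := vert - α • ν

theorem orth_apply (ν X : FrameIdx n → R) : orth ν X = X - ip X ν • ν := rfl

theorem mem_horFields {ν X : FrameIdx n → R} :
    X ∈ horFields ν ↔ ip X ν = 0 ∧ ip X vert = 0 := by
  rw [ip_comm X, ip_comm X]
  rfl

theorem orth_eq_self {ν X : FrameIdx n → R} (h : ip X ν = 0) : orth ν X = X := by
  rw [orth_apply, h, zero_smul, sub_zero]

theorem orth_smul_self {ν : FrameIdx n → R} (h : ip ν ν = 1) (f : R) : orth ν (f • ν) = 0 := by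
  simp [orth_apply, h]

theorem vert_vert : ip (vert : FrameIdx n → R) vert = 1 := by
  rw [ip_vert, vert, Pi.single_eq_same]

theorem ip_cplx_self_vert (A : FrameIdx n → R) : ip (cplx A) vert = 0 := by
  rw [ip_vert, cplx_vert_coeff]

section

variable {ν : FrameIdx n → R} {α : R}

theorem tangent_of_mem {X : FrameIdx n → R} (h : X ∈ horFields ν) :
    ip X (ν + α • vert) = 0 := by
  simp [(mem_horFields.1 h).1, (mem_horFields.1 h).2]

theorem ip_conn_nu (Z : FrameIdx n → R) {X : FrameIdx n → R} (h : X ∈ horFields ν) :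
    ip (conn D Z X) ν = - ip (conn D Z ν) X := by
  have h1 := conn_ip D Z X ν
  rw [(mem_horFields.1 h).1, map_zero, ip_comm X] at h1
  linear_combination -h1

theorem conn_eq (Z : FrameIdx n → R) {X : FrameIdx n → R} (h : X ∈ horFields ν) :
    conn D Z X = orth ν (conn D Z X) - ip (conn D Z ν) X • ν := by
  rw [orth_apply, ip_conn_nu D Z h]
  module

theorem ip_orth (X : FrameIdx n → R) {Y : FrameIdx n → R}
    (hY : Y ∈ horFields ν) : ip (orth ν X) Y = ip X Y := by
  have h := (mem_horFields.1 hY).1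
  rw [ip_comm] at h
  simp [orth_apply, h]

theorem orth_self {X : FrameIdx n → R} (hX : X ∈ horFields ν) :
    orth ν X = X :=
  orth_eq_self (mem_horFields.1 hX).1

theorem D_ip_orth_conn (X : FrameIdx n → R) {Y Z : FrameIdx n → R}
    (hY : Y ∈ horFields ν) (hZ : Z ∈ horFields ν) :
    D X (ip Y Z) = ip (orth ν (conn D X Y)) Z + ip Y (orth ν (conn D X Z)) := by
  rw [ip_orth _ hZ, ip_comm Y (orth _ _), ip_orth _ hY, conn_ip, ip_comm Y]

theorem orth_cplx_skew {X Y : FrameIdx n → R}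
    (hX : X ∈ horFields ν) (hY : Y ∈ horFields ν) :
    ip (orth ν (cplx X)) Y = - ip X (orth ν (cplx Y)) := by
  rw [ip_orth _ hY, ip_comm X, ip_orth _ hX, ip_cplx, ip_comm X]

theorem orth_conn_smul (X : FrameIdx n → R) (f : R)
    {Y : FrameIdx n → R} (hY : Y ∈ horFields ν) :
    orth ν (conn D X (f • Y)) = D X f • Y + f • orth ν (conn D X Y) := by
  rw [conn_smul, map_add, map_smul, map_smul, orth_self hY]

theorem conn_transversal (X : FrameIdx n → R) :
    conn D X (transversal ν α) = - D X α • ν - α • conn D X ν := by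
  rw [transversal, map_sub, conn_vert, conn_smul]
  module

theorem cplx_transversal (X : FrameIdx n → R) :
    ip (cplx X) (transversal ν α) = α * ip (cplx ν) X := by
  rw [transversal, map_sub, map_smul, ip_cplx_self_vert, ip_cplx X ν, ip_comm X]
  simp

end

namespace IsHypersurface

variable {D} {m : ℕ} {ν : FrameIdx n → R} {α : R} {E : Fin m → FrameIdx n → R}

theorem vert_nu (S : IsHypersurface D ν α E) : ip vert ν = 0 := by rw [ip_comm, S.nu_vert]

theorem conn_nu_nu (S : IsHypersurface D ν α E) (X : FrameIdx n → R) : ip (conn D X ν) ν = 0 := by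
  have h := conn_ip D X ν ν
  rw [S.nu_nu, Derivation.map_one_eq_zero, ip_comm ν] at h
  exact S.two_torsion _ (by linear_combination -h)

theorem conn_nu_mem (S : IsHypersurface D ν α E) (X : FrameIdx n → R) :
    conn D X ν ∈ horFields ν := by
  rw [mem_horFields, ip_conn_vert, S.nu_vert, map_zero]
  exact ⟨S.conn_nu_nu X, rfl⟩

theorem orth_nu (S : IsHypersurface D ν α E) (X : FrameIdx n → R) : ip (orth ν X) ν = 0 := by
  simp [orth_apply, S.nu_nu]

theorem orth_vert (S : IsHypersurface D ν α E) (X : FrameIdx n → R) :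
    ip (orth ν X) vert = ip X vert := by
  simp [orth_apply, S.nu_vert]

theorem orth_mem (S : IsHypersurface D ν α E) {X : FrameIdx n → R} (h : ip X vert = 0) :
    orth ν X ∈ horFields ν :=
  mem_horFields.2 ⟨S.orth_nu X, (S.orth_vert X).trans h⟩

theorem orth_conn_mem (S : IsHypersurface D ν α E) (Z : FrameIdx n → R) {X : FrameIdx n → R}
    (h : X ∈ horFields ν) :
    orth ν (conn D Z X) ∈ horFields ν :=
  S.orth_mem (by rw [ip_conn_vert, (mem_horFields.1 h).2, map_zero])

theorem transversal_tangent (S : IsHypersurface D ν α E) : ip (transversal ν α)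
    (ν + α • vert) = 0 := by
  simp [transversal, vert_vert, S.nu_nu, S.nu_vert, S.vert_nu]

theorem cplx_nu_mem (S : IsHypersurface D ν α E) : cplx ν ∈ horFields ν := by
  refine mem_horFields.2 ⟨?_, ip_cplx_self_vert ν⟩
  have h := ip_cplx ν ν
  rw [ip_comm ν] at h
  exact S.two_torsion _ (by linear_combination h)

theorem conn_comm (S : IsHypersurface D ν α E) {X Y : FrameIdx n → R} (hX : ip X (ν + α • vert) = 0)
    (hY : ip Y (ν + α • vert) = 0) (A : FrameIdx n → R) :
    conn D X (conn D Y A) - conn D Y (conn D X A) = conn D (bracket D X Y) A :=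
  funext fun i => S.commutator X Y hX hY (A i)

theorem conn_nu_swap (S : IsHypersurface D ν α E) {X Y : FrameIdx n → R} (hX : X ∈ horFields ν)
    (hY : Y ∈ horFields ν) :
    ip (conn D Y ν) X = ip (conn D X ν) Y + 2 * α * ip (cplx X) Y := by
  have h := S.bracket_tangent X Y (tangent_of_mem hX) (tangent_of_mem hY)
  simp only [bracket, map_sub, map_add, map_smul, LinearMap.sub_apply, LinearMap.smul_apply,
    smul_eq_mul, ip_conn_vert, (mem_horFields.1 hX).2, (mem_horFields.1 hY).2, map_zero,
    ip_conn_nu D X hY, ip_conn_nu D Y hX, vert_vert, S.vert_nu] at h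
  linear_combination h

theorem bracket_eq (S : IsHypersurface D ν α E) {X Y : FrameIdx n → R} (hX : X ∈ horFields ν)
    (hY : Y ∈ horFields ν) :
    bracket D X Y = orth ν (conn D X Y) - orth ν (conn D Y X)
      - (2 * ip (cplx X) Y) • transversal ν α := by
  have h1 := conn_eq D X hY
  have h2 := conn_eq D Y hX
  have h3 := congrArg (· • ν) (S.conn_nu_swap hX hY)
  rw [bracket, transversal]
  linear_combination (norm := module) h1 - h2 + h3

theorem ip_conn_transversal_nu (S : IsHypersurface D ν α E) {X : FrameIdx n → R}
    (hX : X ∈ horFields ν) :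
    ip (conn D (transversal ν α) ν) X = D X α + 2 * α ^ 2 * ip (cplx ν) X := by
  have h := S.bracket_tangent X _ (tangent_of_mem hX) S.transversal_tangent
  rw [bracket, conn_transversal D, cplx_transversal] at h
  simp only [map_sub, map_add, map_smul, LinearMap.sub_apply, LinearMap.smul_apply,
    smul_eq_mul, ip_conn_vert, (mem_horFields.1 hX).2, map_zero, S.nu_nu, S.nu_vert,
    S.conn_nu_nu, ip_conn_nu D _ hX, vert_vert, S.vert_nu] at h
  linear_combination h

theorem bracket_transversal (S : IsHypersurface D ν α E) {X : FrameIdx n → R}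
    (hX : X ∈ horFields ν) :
    bracket D X (transversal ν α) = - α • conn D X ν - orth ν (conn D (transversal ν α) X)
      - (2 * α * ip (cplx ν) X) • transversal ν α := by
  have h := conn_eq D (transversal ν α) hX
  rw [S.ip_conn_transversal_nu hX] at h
  rw [bracket, conn_transversal D, cplx_transversal]
  have e : transversal ν α = vert - α • ν := rfl
  linear_combination (norm := module) (2 * α * ip (cplx ν) X) • e - h

theorem orth_cplx_nu (S : IsHypersurface D ν α E) : orth ν (cplx (cplx ν)) = 0 := by
  rw [cplx_cplx, S.nu_vert, zero_smul, add_zero, ← neg_one_smul R, orth_smul_self S.nu_nu]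

theorem orth_cplx_orth (S : IsHypersurface D ν α E) (X : FrameIdx n → R) :
    orth ν (cplx (orth ν X)) = orth ν (cplx X) - ip X ν • cplx ν := by
  conv_lhs => rw [orth_apply ν X]
  rw [map_sub, map_sub, map_smul, map_smul, orth_self S.cplx_nu_mem]

theorem orth_cplx_orth_cplx (S : IsHypersurface D ν α E) {X : FrameIdx n → R}
    (hX : X ∈ horFields ν) :
    orth ν (cplx (orth ν (cplx X))) = - X + ip (cplx ν) X • cplx ν := by
  rw [S.orth_cplx_orth, cplx_cplx, (mem_horFields.1 hX).2, zero_smul, add_zero, map_neg,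
    orth_self hX, ip_cplx X, ip_comm X]
  module

theorem ip_cplx_nu_cplx_nu (S : IsHypersurface D ν α E) : ip (cplx ν) (cplx ν) = 1 := by
  rw [ip_cplx, cplx_cplx, S.nu_vert, zero_smul, add_zero, map_neg, S.nu_nu, neg_neg]

theorem orth_conn_nu (S : IsHypersurface D ν α E) (X : FrameIdx n → R) :
    orth ν (conn D X ν) = conn D X ν :=
  orth_self (S.conn_nu_mem X)

theorem orth_conn_orth (S : IsHypersurface D ν α E) (X Y : FrameIdx n → R) :
    orth ν (conn D X (orth ν Y)) = orth ν (conn D X Y) - ip Y ν • conn D X ν := by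
  rw [orth_apply ν Y, map_sub, conn_smul, map_sub, map_add, orth_smul_self S.nu_nu, map_smul,
    S.orth_conn_nu, zero_add]

theorem orth_conn_orth_cplx (S : IsHypersurface D ν α E) (X : FrameIdx n → R)
    {Y : FrameIdx n → R} (hY : Y ∈ horFields ν) :
    orth ν (conn D X (orth ν (cplx Y))) = orth ν (cplx (orth ν (conn D X Y)))
      - ip (conn D X ν) Y • cplx ν + ip (cplx ν) Y • conn D X ν := by
  rw [S.orth_conn_orth, S.orth_cplx_orth, conn_cplx, ip_conn_nu D X hY, ip_cplx, ip_comm Y]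
  module

theorem orth_conn_orth_conn (S : IsHypersurface D ν α E) (X Y : FrameIdx n → R)
    {Z : FrameIdx n → R} (hZ : Z ∈ horFields ν) :
    orth ν (conn D X (orth ν (conn D Y Z))) = orth ν (conn D X (conn D Y Z))
      + ip (conn D Y ν) Z • conn D X ν := by
  rw [S.orth_conn_orth, ip_conn_nu D Y hZ]
  module

theorem orth_conn_comm (S : IsHypersurface D ν α E) {X Y : FrameIdx n → R}
    (hX : X ∈ horFields ν) (hY : Y ∈ horFields ν) (Z : FrameIdx n → R) :
    orth ν (conn D X (conn D Y Z)) - orth ν (conn D Y (conn D X Z)) =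
      orth ν (conn D (orth ν (conn D X Y)) Z) - orth ν (conn D (orth ν (conn D Y X)) Z)
      - (2 * ip (orth ν (cplx X)) Y) • orth ν (conn D (transversal ν α) Z) := by
  rw [← map_sub, S.conn_comm (tangent_of_mem hX) (tangent_of_mem hY), S.bracket_eq hX hY,
    ip_orth _ hY]
  simp only [map_sub, map_smul, AddMonoidHom.sub_apply, AddMonoidHom.smul_apply]

theorem codazzi (S : IsHypersurface D ν α E) {X Y : FrameIdx n → R}
    (hX : X ∈ horFields ν) (hY : Y ∈ horFields ν) :
    orth ν (conn D X (conn D Y ν)) - conn D (orth ν (conn D X Y)) ν =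
      orth ν (conn D Y (conn D X ν)) - conn D (orth ν (conn D Y X)) ν
      - (2 * ip (orth ν (cplx X)) Y) • conn D (transversal ν α) ν := by
  have h := S.orth_conn_comm hX hY ν
  simp only [S.orth_conn_nu] at h
  linear_combination (norm := module) h

theorem curvature (S : IsHypersurface D ν α E) {X Y Z : FrameIdx n → R}
    (hX : X ∈ horFields ν) (hY : Y ∈ horFields ν) (hZ : Z ∈ horFields ν) :
    orth ν (conn D X (orth ν (conn D Y Z))) - orth ν (conn D Y (orth ν (conn D X Z))) =
      orth ν (conn D (orth ν (conn D X Y)) Z) - orth ν (conn D (orth ν (conn D Y X)) Z)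
      - (2 * ip (orth ν (cplx X)) Y) • orth ν (conn D (transversal ν α) Z)
      + ip (conn D Y ν) Z • conn D X ν - ip (conn D X ν) Z • conn D Y ν := by
  rw [S.orth_conn_orth_conn X Y hZ, S.orth_conn_orth_conn Y X hZ]
  linear_combination (norm := module) S.orth_conn_comm hX hY Z

theorem transverse (S : IsHypersurface D ν α E) {X : FrameIdx n → R} (hX : X ∈ horFields ν) :
    orth ν (conn D (transversal ν α) (conn D X ν))
        - conn D (orth ν (conn D (transversal ν α) X)) ν =
      orth ν (conn D X (conn D (transversal ν α) ν)) + α • conn D (conn D X ν) ν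
      + (2 * α * ip (cplx ν) X) • conn D (transversal ν α) ν := by
  have h := congrArg (orth ν) (S.conn_comm (tangent_of_mem hX) S.transversal_tangent ν)
  rw [S.bracket_transversal hX] at h
  simp only [map_sub, map_smul, AddMonoidHom.sub_apply, AddMonoidHom.smul_apply,
    S.orth_conn_nu] at h
  linear_combination (norm := module) -h

/-- The tangential connection on horizontal tangent fields. -/
def horConn (S : IsHypersurface D ν α E) : horFields ν →ₗ[R] horFields ν →+ horFields ν where
  toFun X :=
    { toFun := fun Y => ⟨orth ν (conn D X Y), S.orth_conn_mem X Y.2⟩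
      map_zero' := Subtype.ext (by simp)
      map_add' := fun Y Z => Subtype.ext (by simp) }
  map_add' X Y := AddMonoidHom.ext fun Z => Subtype.ext (by simp)
  map_smul' c X := AddMonoidHom.ext fun Z => Subtype.ext (by simp)

/-- The tangential connection in the direction of `T - α ν`. -/
def transversalConn (S : IsHypersurface D ν α E) : horFields ν →+ horFields ν where
  toFun Y := ⟨orth ν (conn D (transversal ν α) Y), S.orth_conn_mem _ Y.2⟩
  map_zero' := Subtype.ext (by simp)
  map_add' Y Z := Subtype.ext (by simp)

/-- The shape operator `X ↦ ∇_X ν`. -/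
def shape (S : IsHypersurface D ν α E) : horFields ν →ₗ[R] horFields ν where
  toFun X := ⟨conn D X ν, S.conn_nu_mem X⟩
  map_add' X Y := Subtype.ext (by simp)
  map_smul' c X := Subtype.ext (by simp)

/-- The complex structure followed by the projection to horizontal tangent fields. -/
def horCplx (S : IsHypersurface D ν α E) : horFields ν →ₗ[R] horFields ν where
  toFun X := ⟨orth ν (cplx X), S.orth_mem (ip_cplx_self_vert _)⟩
  map_add' X Y := Subtype.ext (by simp)
  map_smul' c X := Subtype.ext (by simp)

/-- The tensor calculus of a minimal hypersurface. -/
def calculus (S : IsHypersurface D ν α E) (hH : ∑ j, ip (conn D (E j) ν) (E j) = 0) :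
    HorizontalCalculus R (horFields ν) m where
  g := ip.domRestrict₁₂ (horFields ν) (horFields ν)
  D := D ∘ₗ (horFields ν).subtype
  nab := S.horConn
  nabs := S.transversalConn
  A := S.shape
  P := S.horCplx
  u := ⟨cplx ν, S.cplx_nu_mem⟩
  a := ⟨conn D (transversal ν α) ν, S.conn_nu_mem _⟩
  α := α
  e j := ⟨E j, S.frame_mem j⟩
  g_comm X Y := ip_comm _ _
  nab_smul X f Y := Subtype.ext (orth_conn_smul D X f Y.2)
  metric X Y Z := D_ip_orth_conn D X Y.2 Z.2
  expand X := Subtype.ext ((S.expand X X.2).trans (by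
    rw [AddSubmonoidClass.coe_finsetSum]
    rfl))
  orthonormal i j := (S.orthonormal i j :)
  P_skew X Y := orth_cplx_skew X.2 Y.2
  P_u := Subtype.ext S.orth_cplx_nu
  P_P X := Subtype.ext (S.orth_cplx_orth_cplx X.2)
  u_u := S.ip_cplx_nu_cplx_nu
  nab_P X Y := Subtype.ext (S.orth_conn_orth_cplx X Y.2)
  nab_u X := Subtype.ext (congrArg (orth ν) (conn_cplx D X ν))
  A_swap X Y := by
    have h := S.conn_nu_swap X.2 Y.2
    rw [← ip_orth (cplx _) Y.2] at h
    exact h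
  g_a X := S.ip_conn_transversal_nu X.2
  codazzi X Y := Subtype.ext (S.codazzi X.2 Y.2)
  curvature X Y Z := Subtype.ext (S.curvature X.2 Y.2 Z.2)
  transverse X := Subtype.ext (S.transverse X.2)
  trace_A := hH

end IsHypersurface

/-- The second fundamental form. -/
def secondForm (ν X Y : FrameIdx n → R) : R := ip (conn D X ν) Y

/-- The covariant derivative of the second fundamental form. -/
def nabForm (ν Z X Y : FrameIdx n → R) : R :=
  D Z (secondForm D ν X Y)
    - (secondForm D ν (orth ν (conn D Z X)) Y + secondForm D ν X (orth ν (conn D Z Y)))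

/-- The second covariant derivative of the second fundamental form. -/
def nabnabForm (ν W Z X Y : FrameIdx n → R) : R :=
  D W (nabForm D ν Z X Y)
    - (nabForm D ν (orth ν (conn D W Z)) X Y + nabForm D ν Z (orth ν (conn D W X)) Y
      + nabForm D ν Z X (orth ν (conn D W Y)))

/-- The Hessian of a function. -/
def hessian (ν : FrameIdx n → R) (f : R) (X Y : FrameIdx n → R) : R :=
  D X (D Y f) - D (orth ν (conn D X Y)) f

/-- The symmetric second fundamental form. -/
def symForm (ν : FrameIdx n → R) (α : R) (X Y : FrameIdx n → R) : R :=
  ip (conn D X ν + α • cplx (X - ip X (cplx ν) • cplx ν)) Y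

/-- `J'` is `J` followed by the projection orthogonal to `ν`. -/
theorem cplx_sub_eq_orth {m : ℕ} {ν : FrameIdx n → R} {α : R} {E : Fin m → FrameIdx n → R}
    (S : IsHypersurface D ν α E) (X : FrameIdx n → R) :
    cplx (X - ip X (cplx ν) • cplx ν) = orth ν (cplx X) := by
  rw [map_sub, map_smul, cplx_cplx, S.nu_vert, orth_apply, ip_cplx X]
  module

/-- Simons' formula for a minimal hypersurface. -/
theorem IsHypersurface.simons {m : ℕ} {ν : FrameIdx n → R} {α : R} {E : Fin m → FrameIdx n → R}
    (S : IsHypersurface D ν α E) (hH : ∑ j, ip (conn D (E j) ν) (E j) = 0)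
    {X Y : FrameIdx n → R} (hX : X ∈ horFields ν) (hY : Y ∈ horFields ν) :
    ∑ j, nabnabForm D ν (E j) (E j) X Y =
      -((∑ i, ∑ j, symForm D ν α (E i) (E j) ^ 2) + 4 * D (cplx ν) α + (m + 3) * α ^ 2)
          * secondForm D ν X Y
        + 8 * α ^ 2 * secondForm D ν X Y
        + 4 * hessian D ν α (orth ν (cplx X)) Y + 4 * hessian D ν α X (orth ν (cplx Y))
        + (16 * α * D (orth ν (cplx X)) α - 8 * α ^ 2 * secondForm D ν X (cplx ν)
            + 4 * D (conn D X ν) α) * ip Y (cplx ν)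
        - 2 * D X α * secondForm D ν Y (cplx ν) - 2 * D Y α * secondForm D ν X (cplx ν)
        + 2 * α * secondForm D ν Y (conn D (orth ν (cplx X)) ν)
        - 2 * α * ip (conn D X (conn D (cplx ν) ν)) Y
        - 4 * α ^ 2 * secondForm D ν (orth ν (cplx X)) (orth ν (cplx Y))
        + 2 * α * ip (cplx (conn D X ν)) (conn D Y ν) := by
  rw [← ip_orth (conn D X _) hY, ← ip_orth (cplx _) (S.conn_nu_mem Y)]
  simp only [symForm, cplx_sub_eq_orth D S]
  exact (S.calculus hH).simons ⟨X, hX⟩ ⟨Y, hY⟩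

end FrameField

noncomputable section

/-- The algebra of smooth functions on an open set `Ω`. -/
def smoothSubalgebra {W : Type*} [NormedAddCommGroup W] [NormedSpace ℝ W] (Ω : Set W) :
    Subalgebra ℝ (Ω → ℝ) where
  carrier := {f | ∃ g : W → ℝ, ContDiffOn ℝ ∞ g Ω ∧ ∀ y : Ω, g y = f y}
  mul_mem' := by
    rintro a b ⟨f, hf, ha⟩ ⟨g, hg, hb⟩
    exact ⟨fun y => f y * g y, hf.mul hg, fun y => by simp [ha, hb]⟩
  add_mem' := by
    rintro a b ⟨f, hf, ha⟩ ⟨g, hg, hb⟩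
    exact ⟨fun y => f y + g y, hf.add hg, fun y => by simp [ha, hb]⟩
  algebraMap_mem' r := ⟨fun _ => r, contDiffOn_const, fun _ => rfl⟩

/-- The ring of smooth functions on an open set `Ω`. -/
def SmoothFun {W : Type*} [NormedAddCommGroup W] [NormedSpace ℝ W] (Ω : Set W) : Type _ :=
  smoothSubalgebra Ω

namespace SmoothFun

variable {W : Type*} [NormedAddCommGroup W] [NormedSpace ℝ W] {Ω : Set W}

instance : CommRing (SmoothFun Ω) := inferInstanceAs (CommRing (smoothSubalgebra Ω))

/-- The element of `SmoothFun Ω` given by a function smooth on `Ω`. -/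
def of (g : W → ℝ) (hg : ContDiffOn ℝ ∞ g Ω) : SmoothFun Ω := ⟨fun y => g y, g, hg, fun _ => rfl⟩

/-- An extension to the whole space. -/
def ext (f : SmoothFun Ω) : W → ℝ := f.2.choose

/-- Evaluation at a point of `Ω`. -/
def ev (y : Ω) : SmoothFun Ω →+* ℝ :=
  (Pi.evalRingHom _ y).comp (smoothSubalgebra Ω).val.toRingHom

theorem ext_of_ev {f g : SmoothFun Ω} (h : ∀ y, ev y f = ev y g) : f = g :=
  Subtype.ext (funext h)

theorem contDiffOn_ext (f : SmoothFun Ω) : ContDiffOn ℝ ∞ (ext f) Ω := f.2.choose_spec.1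

theorem ext_apply (f : SmoothFun Ω) (y : Ω) : ext f y = ev y f := f.2.choose_spec.2 y

theorem differentiableAt_ext (hΩ : IsOpen Ω) (f : SmoothFun Ω) (y : Ω) :
    DifferentiableAt ℝ (ext f) y :=
  ((contDiffOn_ext f).contDiffAt (hΩ.mem_nhds y.2)).differentiableAt (by simp)

theorem fderiv_eq (hΩ : IsOpen Ω) {f : SmoothFun Ω} {g : W → ℝ} (y : Ω)
    (h : ∀ z : Ω, ev z f = g z) : fderiv ℝ (ext f) y = fderiv ℝ g y := by
  refine Filter.EventuallyEq.fderiv_eq ?_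
  filter_upwards [hΩ.mem_nhds y.2] with z hz
  rw [ext_apply f ⟨z, hz⟩, h ⟨z, hz⟩]

/-- The derivation of `SmoothFun Ω` along a smooth vector field. -/
def alongField (hΩ : IsOpen Ω) (ζ : W → W) (hζ : ContDiffOn ℝ ∞ ζ Ω) :
    Derivation ℤ (SmoothFun Ω) (SmoothFun Ω) :=
  Derivation.mk'
    (AddMonoidHom.toIntLinearMap
      { toFun := fun f => of (fun y => fderiv ℝ (ext f) y (ζ y))
          (((contDiffOn_ext f).fderiv_of_isOpen hΩ (by simp)).clm_apply hζ)
        map_zero' := Subtype.ext <| funext fun y => by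
          change fderiv ℝ (ext 0) (y : W) (ζ y) = 0
          rw [fderiv_eq hΩ (g := fun _ => 0) y fun z => rfl]
          simp
        map_add' := fun f g => Subtype.ext <| funext fun y => by
          change fderiv ℝ (ext (f + g)) y (ζ y) =
            fderiv ℝ (ext f) y (ζ y) + fderiv ℝ (ext g) y (ζ y)
          rw [fderiv_eq hΩ (g := fun z => ext f z + ext g z) y fun z => by
            rw [ext_apply, ext_apply]; rfl]
          rw [fderiv_fun_add (differentiableAt_ext hΩ f y) (differentiableAt_ext hΩ g y)]
          rfl })
    fun f g => Subtype.ext <| funext fun y => by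
      change fderiv ℝ (ext (f * g)) y (ζ y) =
        ev y f * fderiv ℝ (ext g) y (ζ y) + ev y g * fderiv ℝ (ext f) y (ζ y)
      rw [fderiv_eq hΩ (g := fun z => ext f z * ext g z) y fun z => by
        rw [ext_apply, ext_apply]; rfl]
      rw [fderiv_fun_mul (differentiableAt_ext hΩ f y) (differentiableAt_ext hΩ g y),
        ext_apply, ext_apply]
      rfl

theorem alongField_apply (hΩ : IsOpen Ω) (ζ : W → W) (hζ : ContDiffOn ℝ ∞ ζ Ω) (f : SmoothFun Ω)
    (y : Ω) : ev y (alongField hΩ ζ hζ f) = fderiv ℝ (ext f) y (ζ y) := rfl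

variable {n : ℕ}

/-- The value at a point of a vector field along `Ω`. -/
def vecAt (X : FrameIdx n → SmoothFun Ω) (y : Ω) : Vec n := WithLp.toLp 2 fun i => ev y (X i)

/-- The vector field on `Ω` that a linear map `Λ` makes of the frame coefficients `X`. -/
def field (Λ : W → Vec n →L[ℝ] W) (X : FrameIdx n → SmoothFun Ω) (y : W) : W :=
  ∑ i, ext (X i) y • Λ y (EuclideanSpace.single i 1)

theorem contDiffOn_field {Λ : W → Vec n →L[ℝ] W} (hΛ : ContDiffOn ℝ ∞ Λ Ω)
    (X : FrameIdx n → SmoothFun Ω) : ContDiffOn ℝ ∞ (field Λ X) Ω :=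
  ContDiffOn.sum fun i _ => (contDiffOn_ext (X i)).smul (hΛ.clm_apply contDiffOn_const)

theorem field_apply (Λ : W → Vec n →L[ℝ] W) (X : FrameIdx n → SmoothFun Ω) (y : Ω) :
    field Λ X y = Λ y (vecAt X y) := by
  have h : vecAt X y = ∑ i, ev y (X i) • EuclideanSpace.single i (1 : ℝ) := by
    conv_lhs => rw [← (EuclideanSpace.basisFun (FrameIdx n) ℝ).sum_repr (vecAt X y)]
    simp [vecAt]
  rw [h, map_sum, field]
  simp only [ext_apply, map_smul]

/-- The derivations along the fields with given frame coefficients. -/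
def deriv (hΩ : IsOpen Ω) {Λ : W → Vec n →L[ℝ] W} (hΛ : ContDiffOn ℝ ∞ Λ Ω) :
    (FrameIdx n → SmoothFun Ω) →ₗ[SmoothFun Ω] Derivation ℤ (SmoothFun Ω) (SmoothFun Ω) :=
  Fintype.linearCombination (SmoothFun Ω) fun i =>
    alongField hΩ (fun y => Λ y (EuclideanSpace.single i 1)) (hΛ.clm_apply contDiffOn_const)

theorem deriv_apply (hΩ : IsOpen Ω) {Λ : W → Vec n →L[ℝ] W} (hΛ : ContDiffOn ℝ ∞ Λ Ω)
    (X : FrameIdx n → SmoothFun Ω) (f : SmoothFun Ω) (y : Ω) :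
    ev y (deriv hΩ hΛ X f) = fderiv ℝ (ext f) y (Λ y (vecAt X y)) := by
  rw [← field_apply, field, map_sum, deriv, Fintype.linearCombination_apply,
    ← Derivation.coeFnAddMonoidHom_apply, map_sum, Finset.sum_apply, map_sum]
  refine Finset.sum_congr rfl fun i _ => ?_
  rw [Derivation.coeFnAddMonoidHom_apply, Derivation.smul_apply, smul_eq_mul, map_mul,
    alongField_apply, map_smul, ext_apply, smul_eq_mul]

theorem deriv_commutator (hΩ : IsOpen Ω) {Λ : W → Vec n →L[ℝ] W} (hΛ : ContDiffOn ℝ ∞ Λ Ω)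
    (X Y : FrameIdx n → SmoothFun Ω) (f : SmoothFun Ω) (y : Ω) :
    ev y (deriv hΩ hΛ X (deriv hΩ hΛ Y f) - deriv hΩ hΛ Y (deriv hΩ hΛ X f)) =
      fderiv ℝ (ext f) y (VectorField.lieBracket ℝ (field Λ X) (field Λ Y) y) := by
  have key : ∀ Z T : FrameIdx n → SmoothFun Ω, ev y (deriv hΩ hΛ Z (deriv hΩ hΛ T f)) =
      fderiv ℝ (fderiv ℝ (ext f)) y (field Λ Z y) (field Λ T y)
        + fderiv ℝ (ext f) y (fderiv ℝ (field Λ T) y (field Λ Z y)) := by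
    intro Z T
    rw [deriv_apply, fderiv_eq hΩ (g := fun z => fderiv ℝ (ext f) z (field Λ T z)) y fun z => by
      rw [deriv_apply, field_apply]]
    have h1 : DifferentiableAt ℝ (fderiv ℝ (ext f)) y :=
      (((contDiffOn_ext f).fderiv_of_isOpen hΩ (m := 1) (by norm_cast)).contDiffAt
        (hΩ.mem_nhds y.2)).differentiableAt (by simp)
    have h2 : DifferentiableAt ℝ (field Λ T) y :=
      ((contDiffOn_field hΛ T).contDiffAt (hΩ.mem_nhds y.2)).differentiableAt (by simp)
    rw [fderiv_clm_apply h1 h2, ← field_apply]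
    simp [add_comm]
  have hsymm : IsSymmSndFDerivAt ℝ (ext f) y :=
    ((contDiffOn_ext f).contDiffAt (hΩ.mem_nhds y.2)).isSymmSndFDerivAt
      (by
        rw [minSmoothness_of_isRCLikeNormedField]
        exact WithTop.coe_le_coe.2 (le_top : (2 : ℕ∞) ≤ ⊤))
  rw [map_sub, key, key, hsymm.eq, VectorField.lieBracket, map_sub]
  ring

end SmoothFun

open FrameField

/-- An immersion `G` of an open set `Ω` as a hypersurface of the Heisenberg group with normal field
`ν`, together with the smooth family `Λ` of left inverses of its differential that vanish
on `ν`. -/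
structure LocalImmersion {n : ℕ} {W : Type*} [NormedAddCommGroup W] [NormedSpace ℝ W]
    (Ω : Set W) (G : W → Heis n) (ν : W → Vec n) (Λ : W → Vec n →L[ℝ] W) : Prop where
  isOpen : IsOpen Ω
  smooth : ContDiffOn ℝ ∞ G Ω
  smooth_left : ContDiffOn ℝ ∞ Λ Ω
  normal : ∀ y ∈ Ω, ∀ v, inner ℝ (coframe (G y) (fderiv ℝ G y v)) (ν y) = 0
  left_inv : ∀ y ∈ Ω, ∀ v, Λ y (coframe (G y) (fderiv ℝ G y v)) = v
  right_inv : ∀ y ∈ Ω, ∀ a : Vec n, inner ℝ a (ν y) = 0 →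
    coframe (G y) (fderiv ℝ G y (Λ y a)) = a

namespace LocalImmersion

open SmoothFun

variable {n : ℕ} {W : Type*} [NormedAddCommGroup W] [NormedSpace ℝ W]
    {Ω : Set W} {G : W → Heis n} {ν : W → Vec n} {Λ : W → Vec n →L[ℝ] W}

theorem _root_.SmoothFun.ev_ip (X Y : FrameIdx n → SmoothFun Ω) (y : Ω) :
    ev y (ip X Y) = inner ℝ (vecAt X y) (vecAt Y y) := by
  simp only [ip_apply, map_sum, map_mul, vecAt, PiLp.inner_apply]
  exact Finset.sum_congr rfl fun i _ => mul_comm _ _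

/-- The derivations along tangent fields. -/
def D (h : LocalImmersion Ω G ν Λ) :
    (FrameIdx n → SmoothFun Ω) →ₗ[SmoothFun Ω] Derivation ℤ (SmoothFun Ω) (SmoothFun Ω) :=
  SmoothFun.deriv h.isOpen h.smooth_left

theorem D_apply (h : LocalImmersion Ω G ν Λ) (X : FrameIdx n → SmoothFun Ω) (f : SmoothFun Ω)
    (y : Ω) : ev y (h.D X f) = fderiv ℝ (ext f) y (Λ y (vecAt X y)) :=
  SmoothFun.deriv_apply h.isOpen h.smooth_left X f y

/-- The coordinates `x_j` of the immersion. -/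
def xCoord (h : LocalImmersion Ω G ν Λ) (j : Fin n) : SmoothFun Ω :=
  of (fun y => (G y).1 j)
    ((EuclideanSpace.proj j : EuclideanSpace ℝ (Fin n) →L[ℝ] ℝ).contDiff.comp_contDiffOn
      (contDiff_fst.comp_contDiffOn h.smooth))

/-- The coordinates `y_j` of the immersion. -/
def yCoord (h : LocalImmersion Ω G ν Λ) (j : Fin n) : SmoothFun Ω :=
  of (fun y => (G y).2.1 j)
    ((EuclideanSpace.proj j : EuclideanSpace ℝ (Fin n) →L[ℝ] ℝ).contDiff.comp_contDiffOn
      (contDiff_fst.comp_contDiffOn (contDiff_snd.comp_contDiffOn h.smooth)))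

/-- The coordinate `t` of the immersion. -/
def tCoord (h : LocalImmersion Ω G ν Λ) : SmoothFun Ω :=
  of (fun y => (G y).2.2) (contDiff_snd.comp_contDiffOn (contDiff_snd.comp_contDiffOn h.smooth))

/-- The frame coefficients of the field that a derivation `∂` makes of the coordinates. -/
def coeffs (h : LocalImmersion Ω G ν Λ) (d : SmoothFun Ω → SmoothFun Ω) :
    FrameIdx n → SmoothFun Ω :=
  Sum.elim (fun j => d (h.xCoord j)) (Sum.elim (fun j => d (h.yCoord j))
    (fun _ => d h.tCoord - ∑ j, (h.yCoord j * d (h.xCoord j) - h.xCoord j * d (h.yCoord j))))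

theorem vecAt_coeffs (h : LocalImmersion Ω G ν Λ) (d : SmoothFun Ω → SmoothFun Ω) (y : Ω) (ζ : W)
    (hd : ∀ f, ev y (d f) = fderiv ℝ (ext f) y ζ) :
    vecAt (h.coeffs d) y = coframe (G y) (fderiv ℝ G y ζ) := by
  have hG : DifferentiableAt ℝ G y :=
    (h.smooth.contDiffAt (h.isOpen.mem_nhds y.2)).differentiableAt (by simp)
  have hx : ∀ j, ev y (d (h.xCoord j)) = (fderiv ℝ G y ζ).1 j := fun j => by
    rw [hd, fderiv_eq h.isOpen (g := fun z => (G z).1 j) y fun z => rfl]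
    exact congrArg (fun L => L ζ) (((EuclideanSpace.proj j : EuclideanSpace ℝ (Fin n) →L[ℝ] ℝ).comp
      (ContinuousLinearMap.fst ℝ _ _)).hasFDerivAt.comp (y : W) hG.hasFDerivAt).fderiv
  have hy : ∀ j, ev y (d (h.yCoord j)) = (fderiv ℝ G y ζ).2.1 j := fun j => by
    rw [hd, fderiv_eq h.isOpen (g := fun z => (G z).2.1 j) y fun z => rfl]
    exact congrArg (fun L => L ζ) (((EuclideanSpace.proj j : EuclideanSpace ℝ (Fin n) →L[ℝ] ℝ).comp
      ((ContinuousLinearMap.fst ℝ _ _).comp (ContinuousLinearMap.snd ℝ _ _))).hasFDerivAt.comp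
        (y : W) hG.hasFDerivAt).fderiv
  have ht : ev y (d h.tCoord) = (fderiv ℝ G y ζ).2.2 := by
    rw [hd, fderiv_eq h.isOpen (g := fun z => (G z).2.2) y fun z => rfl]
    exact congrArg (fun L => L ζ) (((ContinuousLinearMap.snd ℝ _ _).comp
      (ContinuousLinearMap.snd ℝ _ _)).hasFDerivAt.comp (y : W) hG.hasFDerivAt).fderiv
  ext (j | j | j)
  · exact hx j
  · exact hy j
  · change ev y (d h.tCoord - ∑ j, (h.yCoord j * d (h.xCoord j) - h.xCoord j * d (h.yCoord j))) = _
    simp only [map_sub, map_sum, map_mul, hx, hy, ht]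
    rfl

theorem vecAt_injective {X Y : FrameIdx n → SmoothFun Ω} (h : ∀ y, vecAt X y = vecAt Y y) :
    X = Y :=
  funext fun i => ext_of_ev fun y => congrArg (fun v : Vec n => v i) (h y)

/-- A tangent field is recovered from its action on the coordinates. -/
theorem coeffs_D (h : LocalImmersion Ω G ν Λ) {X : FrameIdx n → SmoothFun Ω}
    (hX : ∀ y : Ω, inner ℝ (vecAt X y) (ν y) = 0) : h.coeffs (h.D X) = X :=
  vecAt_injective fun y => by
    rw [h.vecAt_coeffs _ y _ fun f => h.D_apply X f y, h.right_inv y y.2 _ (hX y)]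

theorem bracket_eq_coeffs (h : LocalImmersion Ω G ν Λ) {X Y : FrameIdx n → SmoothFun Ω}
    (hX : ∀ y : Ω, inner ℝ (vecAt X y) (ν y) = 0) (hY : ∀ y : Ω, inner ℝ (vecAt Y y) (ν y) = 0) :
    bracket h.D X Y = h.coeffs fun f => h.D X (h.D Y f) - h.D Y (h.D X f) := by
  have eX := h.coeffs_D hX
  have eY := h.coeffs_D hY
  have xl : ∀ j, X (Sum.inl j) = h.D X (h.xCoord j) := fun j => (congrFun eX (Sum.inl j)).symm
  have xr : ∀ j, X (Sum.inr (Sum.inl j)) = h.D X (h.yCoord j) :=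
    fun j => (congrFun eX (Sum.inr (Sum.inl j))).symm
  have yl : ∀ j, Y (Sum.inl j) = h.D Y (h.xCoord j) := fun j => (congrFun eY (Sum.inl j)).symm
  have yr : ∀ j, Y (Sum.inr (Sum.inl j)) = h.D Y (h.yCoord j) :=
    fun j => (congrFun eY (Sum.inr (Sum.inl j))).symm
  have xt : X (Sum.inr (Sum.inr ())) = h.D X h.tCoord - ∑ j, (h.yCoord j * h.D X (h.xCoord j)
      - h.xCoord j * h.D X (h.yCoord j)) := (congrFun eX (Sum.inr (Sum.inr ()))).symm
  have yt : Y (Sum.inr (Sum.inr ())) = h.D Y h.tCoord - ∑ j, (h.yCoord j * h.D Y (h.xCoord j)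
      - h.xCoord j * h.D Y (h.yCoord j)) := (congrFun eY (Sum.inr (Sum.inr ()))).symm
  ext1 i
  rcases i with j | j | j
  · simp [bracket_apply, vert, coeffs, xl, yl]
  · simp [bracket_apply, vert, coeffs, xr, yr]
  · have hip : ip (cplx X) Y = ∑ j, (h.D X (h.xCoord j) * h.D Y (h.yCoord j)
        - h.D X (h.yCoord j) * h.D Y (h.xCoord j)) := by
      simp only [ip_apply, Fintype.sum_sum_type, cplx, LinearMap.coe_mk, AddHom.coe_mk,
        Sum.elim_inl, Sum.elim_inr, xl, xr, yl, yr]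
      simp [Finset.sum_sub_distrib]
      ring
    have hs : ∑ j, h.D X (h.yCoord j * h.D Y (h.xCoord j) - h.xCoord j * h.D Y (h.yCoord j))
        - ∑ j, h.D Y (h.yCoord j * h.D X (h.xCoord j) - h.xCoord j * h.D X (h.yCoord j))
        + ∑ j, 2 * (h.D X (h.xCoord j) * h.D Y (h.yCoord j)
          - h.D X (h.yCoord j) * h.D Y (h.xCoord j)) =
        ∑ j, (h.yCoord j * (h.D X (h.D Y (h.xCoord j)) - h.D Y (h.D X (h.xCoord j)))
          - h.xCoord j * (h.D X (h.D Y (h.yCoord j)) - h.D Y (h.D X (h.yCoord j)))) := by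
      rw [← Finset.sum_sub_distrib, ← Finset.sum_add_distrib]
      refine Finset.sum_congr rfl fun j _ => ?_
      simp only [map_sub, Derivation.leibniz, smul_eq_mul]
      ring
    rw [← Finset.mul_sum, ← hip, ← map_sum, ← map_sum] at hs
    have hb : bracket h.D X Y (Sum.inr (Sum.inr j)) = h.D X (Y (Sum.inr (Sum.inr ())))
        - h.D Y (X (Sum.inr (Sum.inr ()))) - 2 * ip (cplx X) Y := by
      simp [bracket_apply, vert]
    rw [hb, xt, yt, map_sub, map_sub]
    simp only [coeffs, Sum.elim_inr]
    linear_combination -hs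

theorem ev_D_comm (h : LocalImmersion Ω G ν Λ) (X Y : FrameIdx n → SmoothFun Ω) (y : Ω)
    (f : SmoothFun Ω) : ev y (h.D X (h.D Y f) - h.D Y (h.D X f)) =
      fderiv ℝ (ext f) y (VectorField.lieBracket ℝ (field Λ X) (field Λ Y) y) :=
  deriv_commutator h.isOpen h.smooth_left X Y f y

theorem inner_bracket (h : LocalImmersion Ω G ν Λ) {X Y : FrameIdx n → SmoothFun Ω}
    (hX : ∀ y : Ω, inner ℝ (vecAt X y) (ν y) = 0) (hY : ∀ y : Ω, inner ℝ (vecAt Y y) (ν y) = 0)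
    (y : Ω) : inner ℝ (vecAt (bracket h.D X Y) y) (ν y) = 0 := by
  rw [h.bracket_eq_coeffs hX hY, h.vecAt_coeffs _ y _ (h.ev_D_comm X Y y)]
  exact h.normal y y.2 _

theorem commutator (h : LocalImmersion Ω G ν Λ) {X Y : FrameIdx n → SmoothFun Ω}
    (hX : ∀ y : Ω, inner ℝ (vecAt X y) (ν y) = 0) (hY : ∀ y : Ω, inner ℝ (vecAt Y y) (ν y) = 0)
    (f : SmoothFun Ω) : h.D X (h.D Y f) - h.D Y (h.D X f) = h.D (bracket h.D X Y) f :=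
  ext_of_ev fun y => by
    rw [h.D_apply, h.bracket_eq_coeffs hX hY, h.vecAt_coeffs _ y _ (h.ev_D_comm X Y y),
      h.left_inv y y.2, h.ev_D_comm]

end LocalImmersion

namespace Heisenberg

theorem coframe_injective {n : ℕ} (q : Heis n) : Function.Injective (coframe q) :=
  Function.LeftInverse.injective (ofFrame_coframe q)

theorem contDiff_coframe {n : ℕ} :
    ContDiff ℝ ∞ fun p : Heis n × Heis n => coframe p.1 p.2 := by
  have hp : ∀ j, ContDiff ℝ ∞ fun v : EuclideanSpace ℝ (Fin n) => v j := fun j =>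
    (EuclideanSpace.proj j : EuclideanSpace ℝ (Fin n) →L[ℝ] ℝ).contDiff
  have h1 : ∀ j, ContDiff ℝ ∞ fun p : Heis n × Heis n => p.1.1 j := fun j =>
    (hp j).comp (contDiff_fst.comp contDiff_fst)
  have h2 : ∀ j, ContDiff ℝ ∞ fun p : Heis n × Heis n => p.1.2.1 j := fun j =>
    (hp j).comp (contDiff_fst.comp (contDiff_snd.comp contDiff_fst))
  have h3 : ∀ j, ContDiff ℝ ∞ fun p : Heis n × Heis n => p.2.1 j := fun j =>
    (hp j).comp (contDiff_fst.comp contDiff_snd)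
  have h4 : ∀ j, ContDiff ℝ ∞ fun p : Heis n × Heis n => p.2.2.1 j := fun j =>
    (hp j).comp (contDiff_fst.comp (contDiff_snd.comp contDiff_snd))
  have h5 : ContDiff ℝ ∞ fun p : Heis n × Heis n => p.2.2.2 :=
    contDiff_snd.comp (contDiff_snd.comp contDiff_snd)
  refine contDiff_euclidean.2 fun i => ?_
  rcases i with j | j | j
  · exact h3 j
  · exact h4 j
  · exact h5.sub (ContDiff.sum fun j _ => ((h2 j).mul (h3 j)).sub ((h1 j).mul (h4 j)))

end Heisenberg

theorem exists_localImmersion {n : ℕ} {W : Type*} [NormedAddCommGroup W] [NormedSpace ℝ W]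
    [FiniteDimensional ℝ W] (hW : Module.finrank ℝ W = 2 * n) {Ω : Set W} (hΩ : IsOpen Ω)
    {G : W → Heis n} (hG : ContDiffOn ℝ ∞ G Ω)
    (hinj : ∀ y ∈ Ω, Function.Injective (fderiv ℝ G y)) {ν : W → Vec n}
    (hν : ContDiffOn ℝ ∞ ν Ω) (hν0 : ∀ y ∈ Ω, ν y ≠ 0)
    (hnormal : ∀ y ∈ Ω, ∀ v, inner ℝ (coframe (G y) (fderiv ℝ G y v)) (ν y) = 0) :
    ∃ Λ, LocalImmersion Ω G ν Λ := by
  let Ψ : W → W × ℝ →L[ℝ] Vec n := fun y => LinearMap.toContinuousLinearMap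
    (((coframe (G y)).comp (fderiv ℝ G y).toLinearMap).coprod
      (LinearMap.toSpanSingleton ℝ (Vec n) (ν y)))
  have hΨ : ∀ y v c, Ψ y (v, c) = coframe (G y) (fderiv ℝ G y v) + c • ν y := fun y v c => by
    simp [Ψ]
  have hΨinj : ∀ y ∈ Ω, Function.Injective (Ψ y) := by
    intro y hy
    rw [injective_iff_map_eq_zero]
    rintro ⟨v, c⟩ h
    rw [hΨ] at h
    have h1 : c = 0 := by
      have h2 := congrArg (fun w => inner ℝ w (ν y)) h
      simp only [inner_add_left, hnormal y hy, inner_zero_left, real_inner_smul_left,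
        zero_add, mul_eq_zero, inner_self_eq_zero] at h2
      exact h2.resolve_right (hν0 y hy)
    rw [h1, zero_smul, add_zero] at h
    have h3 : v = 0 := hinj y hy (coframe_injective _ (by rw [h, map_zero, map_zero]))
    rw [h1, h3, Prod.mk_zero_zero]
  have hdim : Module.finrank ℝ (W × ℝ) = Module.finrank ℝ (Vec n) := by
    simp [hW]
    ring
  have hequiv : ∀ y ∈ Ω, ∃ e : (W × ℝ) ≃L[ℝ] Vec n, (e : W × ℝ →L[ℝ] Vec n) = Ψ y := by
    intro y hy
    refine ⟨(LinearEquiv.ofInjectiveOfFinrankEq (Ψ y).toLinearMap (hΨinj y hy)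
      hdim).toContinuousLinearEquiv, ?_⟩
    ext v <;> rfl
  have hsm : ContDiffOn ℝ ∞ Ψ Ω := by
    refine contDiffOn_clm_apply.2 fun v => ?_
    have h1 : ContDiffOn ℝ ∞ (fun y => fderiv ℝ G y v.1) Ω :=
      (hG.fderiv_of_isOpen hΩ (by simp)).clm_apply contDiffOn_const
    refine ((contDiff_coframe.comp_contDiffOn (hG.prodMk h1)).add
      (hν.const_smul v.2)).congr fun y _ => ?_
    exact hΨ y v.1 v.2
  have hinv : ∀ y ∈ Ω, ∀ w, (Ψ y).inverse (Ψ y w) = w := by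
    intro y hy w
    obtain ⟨e, he⟩ := hequiv y hy
    rw [← he, ContinuousLinearMap.inverse_equiv]
    exact e.symm_apply_apply w
  have hsurj : ∀ y ∈ Ω, ∀ a, Ψ y ((Ψ y).inverse a) = a := by
    intro y hy a
    obtain ⟨e, he⟩ := hequiv y hy
    rw [← he, ContinuousLinearMap.inverse_equiv]
    exact e.apply_symm_apply a
  refine ⟨fun y => (ContinuousLinearMap.fst ℝ W ℝ).comp (Ψ y).inverse, hΩ, hG, ?_, hnormal, ?_, ?_⟩
  · intro y hy
    obtain ⟨e, he⟩ := hequiv y hy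
    have h1 : ContDiffAt ℝ ∞ ContinuousLinearMap.inverse (Ψ y) := he ▸ contDiffAt_map_inverse e
    exact contDiffWithinAt_const.clm_comp (h1.comp_contDiffWithinAt y (hsm y hy))
  · intro y hy v
    have h := hinv y hy (v, 0)
    rw [hΨ, zero_smul, add_zero] at h
    simp [h]
  · intro y hy a ha
    have h := hsurj y hy a
    rcases hw : (Ψ y).inverse a with ⟨v, c⟩
    rw [hw, hΨ] at h
    have h1 : c = 0 := by
      have h2 := congrArg (fun w => inner ℝ w (ν y)) h
      simp only [inner_add_left, hnormal y hy, ha, real_inner_smul_left,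
        zero_add, mul_eq_zero, inner_self_eq_zero] at h2
      exact h2.resolve_right (hν0 y hy)
    rw [h1, zero_smul, add_zero] at h
    simp [hw, h]

open SmoothFun

/-- `ψ` parametrizes an open part of the immersed hypersurface `F` by an open set `Ω` so that
derivatives of functions can be computed through `ψ`. -/
structure LocalParam {n : ℕ} {M : Type*} [TopologicalSpace M]
    [ChartedSpace (EuclideanSpace ℝ (Fin (2 * n))) M] (F : M → Heis n)
    (Ω : Set (EuclideanSpace ℝ (Fin (2 * n)))) (ψ : EuclideanSpace ℝ (Fin (2 * n)) → M)
    (ν : EuclideanSpace ℝ (Fin (2 * n)) → Vec n)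
    (Λ : EuclideanSpace ℝ (Fin (2 * n)) → Vec n →L[ℝ] EuclideanSpace ℝ (Fin (2 * n))) : Prop where
  immersion : LocalImmersion Ω (F ∘ ψ) ν Λ
  mfderiv_lift : ∀ {V : Type} [NormedAddCommGroup V] [NormedSpace ℝ V] (f : M → V)
    (g : EuclideanSpace ℝ (Fin (2 * n)) → V) (y : Ω), DifferentiableAt ℝ g y →
    (∀ z : Ω, f (ψ z) = g z) → ∀ a : Vec n, inner ℝ a (ν y) = 0 →
    mfderiv (𝓡 (2 * n)) 𝓘(ℝ, V) f (ψ y) (lift F (ψ y) a) = fderiv ℝ g y (Λ y a)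

section Chart

variable {n : ℕ} {M : Type*} [TopologicalSpace M]
    [ChartedSpace (EuclideanSpace ℝ (Fin (2 * n))) M] {F : M → Heis n}

theorem Heisenberg.frameDiff_injective (hF : IsImmersedHypersurface F) (p : M) :
    Function.Injective (frameDiff F p) :=
  (coframe_injective _).comp (hF.injective p)

variable [IsManifold (𝓡 (2 * n)) ∞ M]

theorem contDiffOn_chart_symm {V : Type*} [NormedAddCommGroup V] [NormedSpace ℝ V] (x : M)
    {U : Set M} {f : M → V} (hf : ContMDiffOn (𝓡 (2 * n)) 𝓘(ℝ, V) ∞ f U) :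
    ContDiffOn ℝ ∞ (f ∘ (chartAt (EuclideanSpace ℝ (Fin (2 * n))) x).symm)
      ((chartAt (EuclideanSpace ℝ (Fin (2 * n))) x).target ∩
        (chartAt (EuclideanSpace ℝ (Fin (2 * n))) x).symm ⁻¹' U) :=
  contMDiffOn_iff_contDiffOn.1 (hf.comp
    (contMDiffOn_chart_symm.mono Set.inter_subset_left) fun _ hy => hy.2)

theorem mfderiv_comp_chart_symm {V : Type*} [NormedAddCommGroup V] [NormedSpace ℝ V] (x : M)
    {y : EuclideanSpace ℝ (Fin (2 * n))}
    (hy : y ∈ (chartAt (EuclideanSpace ℝ (Fin (2 * n))) x).target) {f : M → V}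
    {g : EuclideanSpace ℝ (Fin (2 * n)) → V} (hg : DifferentiableAt ℝ g y)
    (hfg : f ∘ (chartAt (EuclideanSpace ℝ (Fin (2 * n))) x).symm =ᶠ[nhds y] g)
    (w : EuclideanSpace ℝ (Fin (2 * n))) :
    mfderiv (𝓡 (2 * n)) 𝓘(ℝ, V) f ((chartAt (EuclideanSpace ℝ (Fin (2 * n))) x).symm y)
      (mfderiv (𝓡 (2 * n)) (𝓡 (2 * n)) (chartAt (EuclideanSpace ℝ (Fin (2 * n))) x).symm y w) =
      fderiv ℝ g y w := by
  set φ := chartAt (EuclideanSpace ℝ (Fin (2 * n))) x with hφ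
  have hat : φ ∈ atlas (EuclideanSpace ℝ (Fin (2 * n))) M := chart_mem_atlas _ x
  have hI : IsManifold (𝓡 (2 * n)) 1 M := IsManifold.of_le (n := ∞) (by simp)
  have h1 : MDifferentiableAt (𝓡 (2 * n)) (𝓡 (2 * n)) φ.symm y :=
    mdifferentiableAt_atlas_symm hat hy
  have h2 : MDifferentiableAt (𝓡 (2 * n)) (𝓡 (2 * n)) φ (φ.symm y) :=
    mdifferentiableAt_atlas hat (φ.map_target hy)
  have h3 : φ (φ.symm y) = y := φ.right_inv hy
  have h4 : f =ᶠ[nhds (φ.symm y)] g ∘ φ := by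
    have hc : Filter.Tendsto φ (nhds (φ.symm y)) (nhds y) := by
      have := φ.continuousAt (φ.map_target hy)
      rwa [ContinuousAt, h3] at this
    filter_upwards [hc.eventually hfg, φ.open_source.mem_nhds (φ.map_target hy)] with p hp hps
    simpa [φ.left_inv hps] using hp
  have h5 : MDifferentiableAt (𝓡 (2 * n)) 𝓘(ℝ, V) f (φ.symm y) := by
    refine MDifferentiableAt.congr_of_eventuallyEq ?_ h4
    refine MDifferentiableAt.comp _ ?_ h2
    rw [h3]
    exact hg.mdifferentiableAt
  have h6 := mfderiv_comp y h5 h1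
  rw [mfderiv_eq_fderiv, hfg.fderiv_eq] at h6
  exact (congrArg (fun L => L w) h6).symm

theorem exists_localParam (hF : IsImmersedHypersurface F) (x : M) {U : Set M} (hU : IsOpen U)
    {ν : M → Vec n} (hν : ContMDiffOn (𝓡 (2 * n)) 𝓘(ℝ, Vec n) ∞ ν U)
    (hν0 : ∀ p ∈ U, ν p ≠ 0) (hnormal : ∀ p ∈ U, ∀ v ∈ tangent F p, inner ℝ (ν p) v = 0) :
    ∃ Λ, LocalParam F ((chartAt (EuclideanSpace ℝ (Fin (2 * n))) x).target ∩
        (chartAt (EuclideanSpace ℝ (Fin (2 * n))) x).symm ⁻¹' U)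
      (chartAt (EuclideanSpace ℝ (Fin (2 * n))) x).symm
      (ν ∘ (chartAt (EuclideanSpace ℝ (Fin (2 * n))) x).symm) Λ := by
  set φ := chartAt (EuclideanSpace ℝ (Fin (2 * n))) x with hφ
  set Ω := φ.target ∩ φ.symm ⁻¹' U with hΩ
  have hΩo : IsOpen Ω := φ.isOpen_inter_preimage_symm hU
  have hG : ContDiffOn ℝ ∞ (F ∘ φ.symm) Ω := contDiffOn_chart_symm x hF.smooth.contMDiffOn
  have hd : ∀ y ∈ Ω, DifferentiableAt ℝ (F ∘ φ.symm) y := fun y hy =>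
    (hG.contDiffAt (hΩo.mem_nhds hy)).differentiableAt (by simp)
  have hdF : ∀ y ∈ Ω, ∀ w, mfderiv (𝓡 (2 * n)) 𝓘(ℝ, Heis n) F (φ.symm y)
      (mfderiv (𝓡 (2 * n)) (𝓡 (2 * n)) φ.symm y w) = fderiv ℝ (F ∘ φ.symm) y w := fun y hy w =>
    mfderiv_comp_chart_symm x hy.1 (hd y hy) Filter.EventuallyEq.rfl w
  have hcof : ∀ y ∈ Ω, ∀ w, frameDiff F (φ.symm y)
      (mfderiv (𝓡 (2 * n)) (𝓡 (2 * n)) φ.symm y w) =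
      coframe ((F ∘ φ.symm) y) (fderiv ℝ (F ∘ φ.symm) y w) := fun y hy w =>
    congrArg (coframe (F (φ.symm y))) (hdF y hy w)
  have hinj : ∀ y ∈ Ω, Function.Injective (fderiv ℝ (F ∘ φ.symm) y) := by
    intro y hy v w h
    have h1 := hF.injective _ ((hdF y hy v).trans (h.trans (hdF y hy w).symm))
    have hI : IsManifold (𝓡 (2 * n)) 1 M := IsManifold.of_le (n := ∞) (by simp)
    exact (mdifferentiable_chart (I := 𝓡 (2 * n)) x).symm.mfderiv_injective hy.1 h1
  obtain ⟨Λ, hΛ⟩ := exists_localImmersion (by simp) hΩo hG hinj (contDiffOn_chart_symm x hν)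
    (fun y hy => hν0 _ hy.2) (fun y hy v => by
      rw [real_inner_comm]
      exact hnormal _ hy.2 _ ⟨_, hcof y hy v⟩)
  refine ⟨Λ, hΛ, fun {V} _ _ f g y hg hfg a ha => ?_⟩
  have hlift : lift F (φ.symm y) a = mfderiv (𝓡 (2 * n)) (𝓡 (2 * n)) φ.symm y (Λ y a) := by
    have h1 := hcof y y.2 (Λ y a)
    rw [hΛ.right_inv y y.2 a ha] at h1
    rw [lift]
    conv_lhs => rw [← h1]
    exact Function.leftInverse_invFun (frameDiff_injective hF _) _
  rw [hlift]
  refine mfderiv_comp_chart_symm x y.2.1 hg ?_ _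
  filter_upwards [hΩo.mem_nhds y.2] with z hz using hfg ⟨z, hz⟩

end Chart

namespace Heisenberg

variable {n : ℕ}

theorem inner_vertical (a : Vec n) : inner ℝ a (vertical n) = a (Sum.inr (Sum.inr ())) := by
  simp [vertical, EuclideanSpace.inner_single_right]

theorem inner_vertical_vertical : inner ℝ (vertical n) (vertical n) = 1 := by
  simp [vertical]

theorem mem_horizontal {a : Vec n} : a ∈ horizontal n ↔ inner ℝ a (vertical n) = 0 := by
  rw [inner_vertical]
  rfl

/-- The horizontal part of a vector. -/
def horPart (a : Vec n) : Vec n := a - (inner ℝ a (vertical n) : ℝ) • vertical n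

theorem contDiff_horPart : ContDiff ℝ ∞ (horPart : Vec n → Vec n) :=
  contDiff_id.sub ((contDiff_id.inner ℝ contDiff_const).smul contDiff_const)

theorem contDiffOn_inv_norm_horPart :
    ContDiffOn ℝ ∞ (fun a : Vec n => ‖horPart a‖⁻¹) {a | horPart a ≠ 0} :=
  (contDiff_horPart.contDiffOn.norm ℝ fun _ h => h).inv fun _ h => norm_ne_zero_iff.2 h

theorem inner_horPart_vertical (a : Vec n) : inner ℝ (horPart a) (vertical n) = 0 := by
  rw [horPart, inner_sub_left, real_inner_smul_left, inner_vertical_vertical, mul_one, sub_self]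

theorem finrank_vec : Module.finrank ℝ (Vec n) = 2 * n + 1 := by
  simp
  ring

/-- A vector orthogonal to `ν` and `T` is a combination of any `2 n - 1` orthonormal vectors
orthogonal to `ν` and `T`. -/
theorem eq_sum_inner_smul {e : Fin (2 * n - 1) → Vec n} (he : Orthonormal ℝ e) {ν v : Vec n}
    (hν : ν ≠ 0) (hνT : inner ℝ ν (vertical n) = 0) (heν : ∀ j, inner ℝ (e j) ν = 0)
    (heT : ∀ j, inner ℝ (e j) (vertical n) = 0) (hvν : inner ℝ v ν = 0)
    (hvT : inner ℝ v (vertical n) = 0) : v = ∑ j, (inner ℝ v (e j) : ℝ) • e j := by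
  set w := v - ∑ j, (inner ℝ v (e j) : ℝ) • e j with hw
  by_contra hne
  have hw0 : w ≠ 0 := fun h => hne (sub_eq_zero.1 h)
  have hwe : ∀ k, inner ℝ w (e k) = 0 := fun k => by
    rw [hw, inner_sub_left, sum_inner]
    simp [real_inner_smul_left, orthonormal_iff_ite.1 he]
  have hwν : inner ℝ w ν = 0 := by
    rw [hw, inner_sub_left, sum_inner]
    simp [real_inner_smul_left, heν, hvν]
  have hwT : inner ℝ w (vertical n) = 0 := by
    rw [hw, inner_sub_left, sum_inner]
    simp [real_inner_smul_left, heT, hvT]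
  have hT0 : vertical n ≠ 0 := fun h => by
    have := inner_vertical_vertical (n := n)
    rw [h, inner_zero_left] at this
    exact zero_ne_one this
  let b : Option (Option (Option (Fin (2 * n - 1)))) → Vec n := fun i =>
    i.elim w fun i => i.elim ν fun i => i.elim (vertical n) e
  have hli : LinearIndependent ℝ b := by
    refine linearIndependent_of_ne_zero_of_inner_eq_zero ?_ ?_
    · rintro (_ | _ | _ | j)
      exacts [hw0, hν, hT0, he.ne_zero j]
    · rintro (_ | _ | _ | j) (_ | _ | _ | k) hjk
      · exact absurd rfl hjk
      · exact hwν
      · exact hwT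
      · exact hwe k
      · exact (real_inner_comm _ _).trans hwν
      · exact absurd rfl hjk
      · exact hνT
      · exact (real_inner_comm _ _).trans (heν k)
      · exact (real_inner_comm _ _).trans hwT
      · exact (real_inner_comm _ _).trans hνT
      · exact absurd rfl hjk
      · exact (real_inner_comm _ _).trans (heT k)
      · exact (real_inner_comm _ _).trans (hwe j)
      · exact heν j
      · exact heT j
      · exact he.2 fun h => hjk (by rw [h])
  have hc := hli.fintype_card_le_finrank
  rw [finrank_vec] at hc
  simp at hc
  omega

theorem horNormal_eq {M : Type*} (N : M → Vec n) (p : M) : horNormal N p = horPart (N p) := rfl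

/-- The multiple `ν + α T` of the normal. -/
def scaledNormal {M : Type*} (N : M → Vec n) (p : M) : Vec n := nu N p + alpha N p • vertical n

theorem scaledNormal_eq {M : Type*} (N : M → Vec n) (p : M) :
    scaledNormal N p = ‖horNormal N p‖⁻¹ • N p := by
  rw [scaledNormal, nu, alpha, div_eq_inv_mul, mul_smul, ← smul_add, horNormal, sub_add_cancel]

theorem inner_nu_vertical {M : Type*} (N : M → Vec n) (p : M) :
    inner ℝ (nu N p) (vertical n) = 0 := by
  rw [nu, real_inner_smul_left, horNormal_eq, inner_horPart_vertical, mul_zero]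

variable {M : Type*} [TopologicalSpace M] [ChartedSpace (EuclideanSpace ℝ (Fin (2 * n))) M]
  {F : M → Heis n} {U : Set M} {N : M → Vec n}

theorem horNormal_ne_zero (hF : IsImmersedHypersurface F) (hUF : U ⊆ nonChar F)
    (hN : IsUnitNormal F U N) {p : M} (hp : p ∈ U) : horNormal N p ≠ 0 := by
  intro h0
  have hNp : N p = (inner ℝ (N p) (vertical n) : ℝ) • vertical n := sub_eq_zero.1 h0
  have hc : (inner ℝ (N p) (vertical n) : ℝ) ≠ 0 := fun hc => by
    have h1 := hN.norm_eq p hp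
    rw [hNp, hc, zero_smul, norm_zero] at h1
    exact zero_ne_one h1
  have hle : tangent F p ≤ horizontal n := fun v hv => by
    have h1 := hN.orthogonal p hp v hv
    rw [hNp, real_inner_smul_left] at h1
    rw [mem_horizontal, real_inner_comm]
    exact (mul_eq_zero.1 h1).resolve_left hc
  refine hUF hp (Submodule.eq_of_le_of_finrank_le hle ?_)
  have h1 : Module.finrank ℝ (tangent F p) = 2 * n := by
    rw [tangent, LinearMap.finrank_range_of_inj (frameDiff_injective hF p)]
    exact finrank_euclideanSpace_fin
  have h2 : horizontal n ≠ ⊤ := fun h => by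
    have h3 : vertical n ∈ horizontal n := h ▸ Submodule.mem_top
    rw [mem_horizontal, inner_vertical_vertical] at h3
    exact one_ne_zero h3
  have h3 := Submodule.finrank_lt h2
  rw [finrank_vec] at h3
  omega

theorem inner_nu_nu (hF : IsImmersedHypersurface F) (hUF : U ⊆ nonChar F)
    (hN : IsUnitNormal F U N) {p : M} (hp : p ∈ U) : inner ℝ (nu N p) (nu N p) = 1 := by
  have h := norm_ne_zero_iff.2 (horNormal_ne_zero hF hUF hN hp)
  rw [nu, real_inner_smul_left, real_inner_smul_right, real_inner_self_eq_norm_sq]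
  field_simp

theorem inner_scaledNormal (hN : IsUnitNormal F U N) {p : M} (hp : p ∈ U) {v : Vec n}
    (hv : v ∈ tangent F p) : inner ℝ (scaledNormal N p) v = 0 := by
  rw [scaledNormal_eq, real_inner_smul_left, hN.orthogonal p hp v hv, mul_zero]

theorem scaledNormal_ne_zero (hF : IsImmersedHypersurface F) (hUF : U ⊆ nonChar F)
    (hN : IsUnitNormal F U N) {p : M} (hp : p ∈ U) : scaledNormal N p ≠ 0 := by
  rw [scaledNormal_eq]
  refine smul_ne_zero (inv_ne_zero (norm_ne_zero_iff.2 (horNormal_ne_zero hF hUF hN hp))) ?_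
  rw [← norm_ne_zero_iff, hN.norm_eq p hp]
  exact one_ne_zero

theorem inner_horTangent_nu (hN : IsUnitNormal F U N) {p : M} (hp : p ∈ U) {v : Vec n}
    (hv : v ∈ horTangent F p) : inner ℝ v (nu N p) = 0 := by
  have h := inner_scaledNormal hN hp hv.2
  have h1 := mem_horizontal.1 hv.1
  rw [real_inner_comm] at h1
  rwa [scaledNormal, inner_add_left, real_inner_smul_left, h1, mul_zero, add_zero,
    real_inner_comm] at h

theorem contMDiffOn_nu (hF : IsImmersedHypersurface F) (hUF : U ⊆ nonChar F)
    (hN : IsUnitNormal F U N) : ContMDiffOn (𝓡 (2 * n)) 𝓘(ℝ, Vec n) ∞ (nu N) U := by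
  have h : ContDiffOn ℝ ∞ (fun a : Vec n => ‖horPart a‖⁻¹ • horPart a) {a | horPart a ≠ 0} :=
    contDiffOn_inv_norm_horPart.smul contDiff_horPart.contDiffOn
  have h1 := h.contMDiffOn.comp hN.smooth fun _ hp => horNormal_ne_zero hF hUF hN hp
  exact h1

theorem contMDiffOn_alpha (hF : IsImmersedHypersurface F) (hUF : U ⊆ nonChar F)
    (hN : IsUnitNormal F U N) : ContMDiffOn (𝓡 (2 * n)) 𝓘(ℝ) ∞ (alpha N) U := by
  have h : ContDiffOn ℝ ∞ (fun a : Vec n => inner ℝ a (vertical n) / ‖horPart a‖)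
      {a | horPart a ≠ 0} := by
    simp only [div_eq_mul_inv]
    exact (contDiff_id.inner ℝ contDiff_const).contDiffOn.mul contDiffOn_inv_norm_horPart
  exact ContMDiffOn.comp h.contMDiffOn hN.smooth fun _ hp => horNormal_ne_zero hF hUF hN hp

theorem contMDiffOn_scaledNormal (hF : IsImmersedHypersurface F) (hUF : U ⊆ nonChar F)
    (hN : IsUnitNormal F U N) : ContMDiffOn (𝓡 (2 * n)) 𝓘(ℝ, Vec n) ∞ (scaledNormal N) U :=
  (contMDiffOn_nu hF hUF hN).add ((contMDiffOn_alpha hF hUF hN).smul contMDiffOn_const)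

theorem nablaS_one (τ : HTensor n M 1) (X Y : M → Vec n) : nablaS F N τ ![X, Y] =
    fun x => dirDeriv F X (τ ![Y]) x - τ ![covS F N X Y] x := by
  funext x
  have h1 : Function.update ![Y] 0 (covS F N X Y) = ![covS F N X Y] := by
    ext i; fin_cases i; rfl
  change _ - ∑ i, τ (Function.update ![Y] i (covS F N X (![Y] i))) x = _
  rw [Fin.sum_univ_one]
  exact congrArg (fun v => _ - τ v x) h1

theorem nablaS_two (τ : HTensor n M 2) (Z X Y : M → Vec n) : nablaS F N τ ![Z, X, Y] =
    fun x => dirDeriv F Z (τ ![X, Y]) x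
      - (τ ![covS F N Z X, Y] x + τ ![X, covS F N Z Y] x) := by
  funext x
  change _ - ∑ i, τ (Function.update ![X, Y] i (covS F N Z (![X, Y] i))) x = _
  rw [Fin.sum_univ_two]
  rw [show Function.update ![X, Y] 0 (covS F N Z (![X, Y] 0)) = ![covS F N Z X, Y] by
      ext1 i; fin_cases i <;> rfl,
    show Function.update ![X, Y] 1 (covS F N Z (![X, Y] 1)) = ![X, covS F N Z Y] by
      ext1 i; fin_cases i <;> rfl]
  rfl

theorem nablaS_three (τ : HTensor n M 3) (W Z X Y : M → Vec n) : nablaS F N τ ![W, Z, X, Y] =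
    fun x => dirDeriv F W (τ ![Z, X, Y]) x
      - (τ ![covS F N W Z, X, Y] x + τ ![Z, covS F N W X, Y] x
        + τ ![Z, X, covS F N W Y] x) := by
  funext x
  change _ - ∑ i, τ (Function.update ![Z, X, Y] i (covS F N W (![Z, X, Y] i))) x = _
  rw [Fin.sum_univ_three]
  rw [show Function.update ![Z, X, Y] 0 (covS F N W (![Z, X, Y] 0)) = ![covS F N W Z, X, Y] by
      ext1 i; fin_cases i <;> rfl,
    show Function.update ![Z, X, Y] 1 (covS F N W (![Z, X, Y] 1)) = ![Z, covS F N W X, Y] by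
      ext1 i; fin_cases i <;> rfl,
    show Function.update ![Z, X, Y] 2 (covS F N W (![Z, X, Y] 2)) = ![Z, X, covS F N W Y] by
      ext1 i; fin_cases i <;> rfl]
  rfl

end Heisenberg

namespace LocalParam

variable {n : ℕ} {M : Type*}
  {Ω : Set (EuclideanSpace ℝ (Fin (2 * n)))} {ψ : EuclideanSpace ℝ (Fin (2 * n)) → M}

/-- `f'` is the expression of the function `f` in the parametrization `ψ`. -/
def Rep (ψ : EuclideanSpace ℝ (Fin (2 * n)) → M) (f : M → ℝ) (f' : SmoothFun Ω) : Prop :=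
  ∀ y : Ω, f (ψ y) = ev y f'

/-- `X'` is the expression of the vector field `X` in the parametrization `ψ`. -/
def RepVec (ψ : EuclideanSpace ℝ (Fin (2 * n)) → M) (X : M → Vec n)
    (X' : FrameIdx n → SmoothFun Ω) : Prop :=
  ∀ y : Ω, X (ψ y) = vecAt X' y

theorem exists_repVec {X : M → Vec n} (h : ContDiffOn ℝ ∞ (X ∘ ψ) Ω) :
    ∃ X' : FrameIdx n → SmoothFun Ω, RepVec ψ X X' :=
  ⟨fun i => of (fun y => X (ψ y) i) (contDiffOn_euclidean.1 h i), fun _ => rfl⟩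

theorem exists_rep {f : M → ℝ} (h : ContDiffOn ℝ ∞ (f ∘ ψ) Ω) :
    ∃ f' : SmoothFun Ω, Rep ψ f f' :=
  ⟨of _ h, fun _ => rfl⟩

theorem vecAt_sub (X Y : FrameIdx n → SmoothFun Ω) (y : Ω) :
    vecAt (X - Y) y = vecAt X y - vecAt Y y := by
  ext i
  simp [vecAt]

theorem vecAt_add (X Y : FrameIdx n → SmoothFun Ω) (y : Ω) :
    vecAt (X + Y) y = vecAt X y + vecAt Y y := by
  ext i
  simp [vecAt]

theorem vecAt_smul (f : SmoothFun Ω) (X : FrameIdx n → SmoothFun Ω) (y : Ω) :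
    vecAt (f • X) y = ev y f • vecAt X y := by
  ext i
  simp [vecAt]

theorem vecAt_sum {m : ℕ} (X : Fin m → FrameIdx n → SmoothFun Ω) (y : Ω) :
    vecAt (∑ j, X j) y = ∑ j, vecAt (X j) y := by
  ext i
  simp [vecAt]

theorem vecAt_cplx (X : FrameIdx n → SmoothFun Ω) (y : Ω) : vecAt (cplx X) y = J (vecAt X y) := by
  ext (j | j | j) <;> simp [vecAt, cplx, J]

theorem vecAt_vert (y : Ω) : vecAt (vert : FrameIdx n → SmoothFun Ω) y = vertical n := by
  ext (j | j | j) <;> simp [vecAt, vert, vertical]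

variable {X Y Z : M → Vec n} {X' Y' Z' : FrameIdx n → SmoothFun Ω}

theorem RepVec.inner (hX : RepVec ψ X X') (hY : RepVec ψ Y Y') :
    Rep ψ (fun p => inner ℝ (X p) (Y p)) (ip X' Y') := fun y => by
  rw [ev_ip, ← hX, ← hY]

theorem RepVec.JF (hX : RepVec ψ X X') : RepVec ψ (JF X) (cplx X') := fun y => by
  rw [vecAt_cplx, ← hX]
  rfl

theorem RepVec.proj {N : M → Vec n} {ν : FrameIdx n → SmoothFun Ω} (hν : RepVec ψ (nu N) ν)
    (hX : RepVec ψ X X') : RepVec ψ (proj N X) (orth ν X') := fun y => by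
  rw [orth_apply, vecAt_sub, vecAt_smul, ev_ip, ← hX, ← hν]
  rfl

variable [TopologicalSpace M] [ChartedSpace (EuclideanSpace ℝ (Fin (2 * n))) M] {F : M → Heis n}
  {η : EuclideanSpace ℝ (Fin (2 * n)) → Vec n}
  {Λ : EuclideanSpace ℝ (Fin (2 * n)) → Vec n →L[ℝ] EuclideanSpace ℝ (Fin (2 * n))}

theorem rep_dirDeriv (P : LocalParam F Ω ψ η Λ) (hX : RepVec ψ X X')
    (ht : ∀ y : Ω, inner ℝ (vecAt X' y) (η y) = 0) {f : M → ℝ} {f' : SmoothFun Ω}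
    (hf : Rep ψ f f') : Rep ψ (dirDeriv F X f) (P.immersion.D X' f') := fun y => by
  rw [P.immersion.D_apply, dirDeriv, hX]
  exact P.mfderiv_lift f (ext f') y (differentiableAt_ext P.immersion.isOpen f' y)
    (fun z => by rw [hf, ext_apply]) _ (ht y)

theorem repVec_cov (P : LocalParam F Ω ψ η Λ) (hX : RepVec ψ X X')
    (ht : ∀ y : Ω, inner ℝ (vecAt X' y) (η y) = 0) (hY : RepVec ψ Y Y') :
    RepVec ψ (cov F X Y) (conn P.immersion.D X' Y') := fun y => by
  have hd : HasFDerivAt (fun z => (WithLp.toLp 2 fun i => ext (Y' i) z : Vec n)) _ (y : _) :=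
    (PiLp.hasFDerivAt_toLp 2 _).comp (y : EuclideanSpace ℝ (Fin (2 * n)))
      (hasFDerivAt_pi.2 fun i =>
        (differentiableAt_ext P.immersion.isOpen (Y' i) y).hasFDerivAt)
  rw [cov, hX]
  have h1 := P.mfderiv_lift Y _ y hd.differentiableAt
    (fun z => by rw [hY]; ext i; exact (ext_apply (Y' i) z).symm) _ (ht y)
  refine h1.trans ?_
  rw [hd.fderiv]
  refine PiLp.ext fun i => ?_
  exact (P.immersion.D_apply X' (Y' i) y).symm

variable {U : Set M} {N : M → Vec n} {ν : FrameIdx n → SmoothFun Ω} {α : SmoothFun Ω}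
  {E : Fin (2 * n - 1) → M → Vec n} {e : Fin (2 * n - 1) → FrameIdx n → SmoothFun Ω}

theorem repVec_mem (hN : IsUnitNormal F U N) (hψ : ∀ y : Ω, ψ y ∈ U) (hν : RepVec ψ (nu N) ν)
    (hX : RepVec ψ X X') (h : IsHorTangentField F U X) : X' ∈ horFields ν := by
  refine mem_horFields.2 ⟨ext_of_ev fun y => ?_, ext_of_ev fun y => ?_⟩
  · rw [ev_ip, ← hX, ← hν, map_zero]
    exact inner_horTangent_nu hN (hψ y) (h.mem _ (hψ y))
  · rw [ev_ip, ← hX, vecAt_vert, map_zero]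
    exact mem_horizontal.1 (h.mem _ (hψ y)).1

theorem isHypersurface (P : LocalParam F Ω ψ η Λ) (hF : IsImmersedHypersurface F)
    (hUF : U ⊆ nonChar F) (hN : IsUnitNormal F U N) (hE : IsHorFrame F U E)
    (hψ : ∀ y : Ω, ψ y ∈ U) (hη : ∀ y : Ω, η y = vecAt (ν + α • vert) y)
    (hν : RepVec ψ (nu N) ν) (he : ∀ j, RepVec ψ (E j) (e j)) :
    IsHypersurface P.immersion.D ν α e := by
  have htan : ∀ X' : FrameIdx n → SmoothFun Ω, ip X' (ν + α • vert) = 0 →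
      ∀ y : Ω, inner ℝ (vecAt X' y) (η y) = 0 := fun X' h y => by
    rw [hη, ← ev_ip, h, map_zero]
  have hmem : ∀ j, e j ∈ horFields ν := fun j => repVec_mem hN hψ hν (he j) (hE.field j)
  refine ⟨fun r hr => ext_of_ev fun y => ?_, ext_of_ev fun y => ?_, ext_of_ev fun y => ?_,
    fun X' Y' hX hY f => P.immersion.commutator (htan X' hX) (htan Y' hY) f,
    fun X' Y' hX hY => ext_of_ev fun y => ?_, hmem,
    fun X' hX => LocalImmersion.vecAt_injective fun y => ?_,
    fun i j => ext_of_ev fun y => ?_⟩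
  · have h := congrArg (ev y) hr
    rw [map_mul, map_zero, map_ofNat] at h
    rw [map_zero]
    linarith
  · rw [ev_ip, ← hν, map_one]
    exact inner_nu_nu hF hUF hN (hψ y)
  · rw [ev_ip, ← hν, vecAt_vert, map_zero]
    exact inner_nu_vertical N _
  · rw [ev_ip, ← hη, map_zero]
    exact P.immersion.inner_bracket (htan X' hX) (htan Y' hY) y
  · have h0 : ∀ A B : FrameIdx n → SmoothFun Ω, ip A B = 0 →
        inner ℝ (vecAt A y) (vecAt B y) = 0 := fun A B h => by rw [← ev_ip, h, map_zero]
    have hν0 : vecAt ν y ≠ 0 := fun h => by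
      have h1 := inner_nu_nu hF hUF hN (hψ y)
      rw [hν, h, inner_zero_left] at h1
      exact zero_ne_one h1
    have ho : Orthonormal ℝ fun j => vecAt (e j) y := by
      simpa only [he _ y] using hE.orthonormal _ (hψ y)
    rw [vecAt_sum]
    simp only [vecAt_smul, ev_ip]
    refine eq_sum_inner_smul ho hν0 ?_ (fun j => h0 _ _ (mem_horFields.1 (hmem j)).1) ?_
      (h0 _ _ (mem_horFields.1 hX).1) ?_
    · rw [← hν]
      exact inner_nu_vertical N _
    · intro j
      rw [← vecAt_vert y]
      exact h0 _ _ (mem_horFields.1 (hmem j)).2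
    · rw [← vecAt_vert y]
      exact h0 _ _ (mem_horFields.1 hX).2
  · rw [ev_ip, ← he, ← he, orthonormal_iff_ite.1 (hE.orthonormal _ (hψ y))]
    split_ifs <;> simp

end LocalParam

/-- A parametrization of a hypersurface with the expressions of its normal, of `α` and of its
frame. -/
structure LocalData {n : ℕ} {M : Type*} [TopologicalSpace M]
    [ChartedSpace (EuclideanSpace ℝ (Fin (2 * n))) M] (F : M → Heis n) (N : M → Vec n)
    (E : Fin (2 * n - 1) → M → Vec n) (Ω : Set (EuclideanSpace ℝ (Fin (2 * n))))
    (ψ : EuclideanSpace ℝ (Fin (2 * n)) → M) (η : EuclideanSpace ℝ (Fin (2 * n)) → Vec n)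
    (Λ : EuclideanSpace ℝ (Fin (2 * n)) → Vec n →L[ℝ] EuclideanSpace ℝ (Fin (2 * n)))
    (ν : FrameIdx n → SmoothFun Ω) (α : SmoothFun Ω)
    (e : Fin (2 * n - 1) → FrameIdx n → SmoothFun Ω) : Prop where
  param : LocalParam F Ω ψ η Λ
  normal_eq : ∀ y : Ω, η y = vecAt (ν + α • vert) y
  rep_nu : LocalParam.RepVec ψ (nu N) ν
  rep_alpha : LocalParam.Rep ψ (alpha N) α
  rep_frame : ∀ j, LocalParam.RepVec ψ (E j) (e j)
  isHypersurface : IsHypersurface param.immersion.D ν α e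

namespace LocalData

open LocalParam

variable {n : ℕ} {M : Type*} [TopologicalSpace M]
  [ChartedSpace (EuclideanSpace ℝ (Fin (2 * n))) M] {F : M → Heis n} {N : M → Vec n}
  {E : Fin (2 * n - 1) → M → Vec n} {Ω : Set (EuclideanSpace ℝ (Fin (2 * n)))}
  {ψ : EuclideanSpace ℝ (Fin (2 * n)) → M} {η : EuclideanSpace ℝ (Fin (2 * n)) → Vec n}
  {Λ : EuclideanSpace ℝ (Fin (2 * n)) → Vec n →L[ℝ] EuclideanSpace ℝ (Fin (2 * n))}
  {ν : FrameIdx n → SmoothFun Ω} {α : SmoothFun Ω}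
  {e : Fin (2 * n - 1) → FrameIdx n → SmoothFun Ω}
  {W X Y Z : M → Vec n} {W' X' Y' Z' : FrameIdx n → SmoothFun Ω}

/-- The derivations along tangent fields. -/
abbrev D (L : LocalData F N E Ω ψ η Λ ν α e) := L.param.immersion.D

theorem rep_dirDeriv (L : LocalData F N E Ω ψ η Λ ν α e) (hX : RepVec ψ X X')
    (hX' : X' ∈ horFields ν) {f : M → ℝ} {f' : SmoothFun Ω} (hf : Rep ψ f f') :
    Rep ψ (dirDeriv F X f) (L.D X' f') :=
  L.param.rep_dirDeriv hX (fun y => by rw [L.normal_eq, ← ev_ip, tangent_of_mem hX', map_zero]) hf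

theorem repVec_cov (L : LocalData F N E Ω ψ η Λ ν α e) (hX : RepVec ψ X X')
    (hX' : X' ∈ horFields ν) (hY : RepVec ψ Y Y') : RepVec ψ (cov F X Y) (conn L.D X' Y') :=
  L.param.repVec_cov hX (fun y => by rw [L.normal_eq, ← ev_ip, tangent_of_mem hX', map_zero]) hY

theorem repVec_covS (L : LocalData F N E Ω ψ η Λ ν α e) (hX : RepVec ψ X X')
    (hX' : X' ∈ horFields ν) (hY : RepVec ψ Y Y') :
    RepVec ψ (covS F N X Y) (orth ν (conn L.D X' Y')) :=
  RepVec.proj L.rep_nu (L.repVec_cov hX hX' hY)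

theorem rep_sff (L : LocalData F N E Ω ψ η Λ ν α e) (hX : RepVec ψ X X')
    (hX' : X' ∈ horFields ν) (hY : RepVec ψ Y Y') :
    Rep ψ (sff F N ![X, Y]) (secondForm L.D ν X' Y') :=
  RepVec.inner (L.repVec_cov hX hX' L.rep_nu) hY

theorem rep_nablaS_sff (L : LocalData F N E Ω ψ η Λ ν α e) (hZ : RepVec ψ Z Z')
    (hZ' : Z' ∈ horFields ν) (hX : RepVec ψ X X') (hX' : X' ∈ horFields ν)
    (hY : RepVec ψ Y Y') :
    Rep ψ (nablaS F N (sff F N) ![Z, X, Y]) (nabForm L.D ν Z' X' Y') := fun y => by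
  rw [nablaS_two, nabForm, map_sub, map_add, ← L.rep_dirDeriv hZ hZ' (L.rep_sff hX hX' hY) y,
    ← L.rep_sff (L.repVec_covS hZ hZ' hX) (L.isHypersurface.orth_conn_mem _ hX') hY y,
    ← L.rep_sff hX hX' (L.repVec_covS hZ hZ' hY) y]

theorem rep_hess_sff (L : LocalData F N E Ω ψ η Λ ν α e) (hW : RepVec ψ W W')
    (hW' : W' ∈ horFields ν) (hZ : RepVec ψ Z Z')
    (hZ' : Z' ∈ horFields ν) (hX : RepVec ψ X X') (hX' : X' ∈ horFields ν)
    (hY : RepVec ψ Y Y') :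
    Rep ψ (hess F N (sff F N) ![W, Z, X, Y]) (nabnabForm L.D ν W' Z' X' Y') := fun y => by
  have hm := fun {A} (hA : A ∈ horFields ν) => L.isHypersurface.orth_conn_mem W' hA
  rw [hess, nablaS_three, nabnabForm, map_sub, map_add, map_add,
    ← L.rep_dirDeriv hW hW' (L.rep_nablaS_sff hZ hZ' hX hX' hY) y,
    ← L.rep_nablaS_sff (L.repVec_covS hW hW' hZ) (hm hZ') hX hX' hY y,
    ← L.rep_nablaS_sff hZ hZ' (L.repVec_covS hW hW' hX) (hm hX') hY y,
    ← L.rep_nablaS_sff hZ hZ' hX hX' (L.repVec_covS hW hW' hY) y]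

theorem rep_hess_alpha (L : LocalData F N E Ω ψ η Λ ν α e) (hX : RepVec ψ X X')
    (hX' : X' ∈ horFields ν) (hY : RepVec ψ Y Y') (hY' : Y' ∈ horFields ν) :
    Rep ψ (hess F N (ofFun (alpha N)) ![X, Y]) (hessian L.D ν α X' Y') := fun y => by
  have h : ∀ A : M → Vec n, nablaS F N (ofFun (alpha N)) ![A] = dirDeriv F A (alpha N) :=
    fun A => funext fun x => by simp [nablaS, ofFun]
  rw [hess, nablaS_one, h, h, hessian, map_sub,
    ← L.rep_dirDeriv hX hX' (L.rep_dirDeriv hY hY' L.rep_alpha) y,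
    ← L.rep_dirDeriv (L.repVec_covS hX hX' hY) (L.isHypersurface.orth_conn_mem _ hY')
      L.rep_alpha y]

theorem rep_symSff (L : LocalData F N E Ω ψ η Λ ν α e) (hX : RepVec ψ X X')
    (hX' : X' ∈ horFields ν) (hY : RepVec ψ Y Y') :
    Rep ψ (symSff F N ![X, Y])
      (symForm L.D ν α X' Y') := fun y => by
  rw [symForm, ev_ip, vecAt_add, vecAt_smul, vecAt_cplx, vecAt_sub, vecAt_smul, ev_ip, vecAt_cplx,
    ← L.repVec_cov hX hX' L.rep_nu y, ← L.rep_alpha y, ← L.rep_nu y, ← hX y, ← hY y]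
  rfl

/-- Simons' formula at a point of a parametrized hypersurface. -/
theorem simons (L : LocalData F N E Ω ψ η Λ ν α e) (hn : 1 ≤ n)
    (hH : ∑ j, ip (conn L.D (e j) ν) (e j) = 0) (rX : RepVec ψ X X') (mX : X' ∈ horFields ν)
    (rY : RepVec ψ Y Y') (mY : Y' ∈ horFields ν) (y : Ω) :
      lap F N E (sff F N) ![X, Y] (ψ y) =
        -stability F N E (ψ y) * sff F N ![X, Y] (ψ y)
        + 8 * alpha N (ψ y) ^ 2 * sff F N ![X, Y] (ψ y)
        + 4 * hess F N (ofFun (alpha N)) ![proj N (JF X), Y] (ψ y)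
        + 4 * hess F N (ofFun (alpha N)) ![X, proj N (JF Y)] (ψ y)
        + (16 * alpha N (ψ y) * dirDeriv F (proj N (JF X)) (alpha N) (ψ y)
            - 8 * alpha N (ψ y) ^ 2 * sff F N ![X, JF (nu N)] (ψ y)
            + 4 * dirDeriv F (cov F X (nu N)) (alpha N) (ψ y)) * inner ℝ (Y (ψ y)) (JF (nu N) (ψ y))
        - 2 * dirDeriv F X (alpha N) (ψ y) * sff F N ![Y, JF (nu N)] (ψ y)
        - 2 * dirDeriv F Y (alpha N) (ψ y) * sff F N ![X, JF (nu N)] (ψ y)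
        + 2 * alpha N (ψ y) * sff F N ![Y, cov F (proj N (JF X)) (nu N)] (ψ y)
        - 2 * alpha N (ψ y) * inner ℝ (cov F X (cov F (JF (nu N)) (nu N)) (ψ y)) (Y (ψ y))
        - 4 * alpha N (ψ y) ^ 2 * sff F N ![proj N (JF X), proj N (JF Y)] (ψ y)
        + 2 * alpha N (ψ y) * inner ℝ (JF (cov F X (nu N)) (ψ y)) (cov F Y (nu N) (ψ y)) := by
  have S := L.isHypersurface
  have H := congrArg (ev y) (S.simons L.D hH mX mY)
  have ru := L.rep_nu.JF
  have mu := S.cplx_nu_mem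
  have rPX := RepVec.proj L.rep_nu rX.JF
  have rPY := RepVec.proj L.rep_nu rY.JF
  have mP : ∀ A : FrameIdx n → SmoothFun _, orth ν (cplx A) ∈ horFields ν :=
    fun A => S.orth_mem (ip_cplx_self_vert A)
  have rAX := L.repVec_cov rX mX L.rep_nu
  have rAY := L.repVec_cov rY mY L.rep_nu
  have rPAX := L.repVec_cov rPX (mP X') L.rep_nu
  have rAu := L.repVec_cov ru mu L.rep_nu
  have t1 : ∀ j, _ = ev y (nabnabForm L.D ν (e j) (e j) X' Y') := fun j =>
    L.rep_hess_sff (L.rep_frame j) (S.frame_mem j) (L.rep_frame j) (S.frame_mem j) rX mX rY y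
  have t2 : ∀ i j, _ = ev y (symForm L.D ν α (e i) (e j)) := fun i j =>
    L.rep_symSff (L.rep_frame i) (S.frame_mem i) (L.rep_frame j) y
  have t3 := L.rep_dirDeriv ru mu L.rep_alpha y
  have t4 := L.rep_alpha y
  have t5 := L.rep_sff rX mX rY y
  have t6 := L.rep_hess_alpha rPX (mP X') rY mY y
  have t7 := L.rep_hess_alpha rX mX rPY (mP Y') y
  have t8 := L.rep_dirDeriv rPX (mP X') L.rep_alpha y
  have t9 := L.rep_sff rX mX ru y
  have t10 := L.rep_dirDeriv rAX (S.conn_nu_mem X') L.rep_alpha y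
  have t11 := rY.inner ru y
  have t12 := L.rep_dirDeriv rX mX L.rep_alpha y
  have t13 := L.rep_sff rY mY ru y
  have t14 := L.rep_dirDeriv rY mY L.rep_alpha y
  have t15 := L.rep_sff rY mY rPAX y
  have t16 := (L.repVec_cov rX mX rAu).inner rY y
  have t17 := L.rep_sff rPX (mP X') rPY y
  have t18 := rAX.JF.inner rAY y
  simp only [map_add, map_sub, map_mul, map_neg, map_sum, map_pow, map_natCast, map_ofNat,
    ← t1, ← t2, ← t3, ← t4, ← t5, ← t6, ← t7, ← t8, ← t9, ← t10, ← t11, ← t12, ← t13, ← t14, ← t15,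
    ← t16, ← t17, ← t18] at H
  have hm : ((2 * n - 1 : ℕ) : ℝ) = 2 * n - 1 := by
    rw [Nat.cast_sub (by omega)]
    push_cast
    ring
  rw [hm] at H
  refine H.trans ?_
  rw [stability]
  ring

end LocalData

theorem Heisenberg.one_le_of_horNormal_ne_zero {n : ℕ} {M : Type*} {N : M → Vec n} {p : M}
    (h : horNormal N p ≠ 0) : 1 ≤ n := by
  by_contra hn
  obtain rfl : n = 0 := by omega
  refine h (PiLp.ext fun i => ?_)
  rcases i with j | j | j
  · exact j.elim0
  · exact j.elim0
  · rw [horNormal_eq, horPart, inner_vertical]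
    simp [vertical]

theorem exists_localData {n : ℕ} {M : Type*} [TopologicalSpace M]
    [ChartedSpace (EuclideanSpace ℝ (Fin (2 * n))) M] [IsManifold (𝓡 (2 * n)) ∞ M]
    {F : M → Heis n} (hF : IsImmersedHypersurface F) {U : Set M} (hU : IsOpen U)
    (hUF : U ⊆ nonChar F) {N : M → Vec n} (hN : IsUnitNormal F U N)
    {E : Fin (2 * n - 1) → M → Vec n} (hE : IsHorFrame F U E) (x : M) :
    ∃ η Λ ν α e, LocalData F N E ((chartAt (EuclideanSpace ℝ (Fin (2 * n))) x).target ∩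
        (chartAt (EuclideanSpace ℝ (Fin (2 * n))) x).symm ⁻¹' U)
      (chartAt (EuclideanSpace ℝ (Fin (2 * n))) x).symm η Λ ν α e := by
  obtain ⟨Λ, P⟩ := exists_localParam hF x hU (contMDiffOn_scaledNormal hF hUF hN)
    (fun p hp => scaledNormal_ne_zero hF hUF hN hp)
    fun p hp v hv => inner_scaledNormal hN hp hv
  obtain ⟨ν, hν⟩ := LocalParam.exists_repVec (contDiffOn_chart_symm x (contMDiffOn_nu hF hUF hN))
  obtain ⟨α, hα⟩ := LocalParam.exists_rep (contDiffOn_chart_symm x (contMDiffOn_alpha hF hUF hN))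
  choose e he using fun j =>
    LocalParam.exists_repVec (contDiffOn_chart_symm x (hE.field j).smooth)
  refine ⟨_, Λ, ν, α, e, P, ?_, hν, hα, he, P.isHypersurface hF hUF hN hE (fun y => y.2.2) ?_ hν he⟩
  all_goals
    intro y
    rw [LocalParam.vecAt_add, LocalParam.vecAt_smul, LocalParam.vecAt_vert, ← hν y, ← hα y]
    rfl

end

theorem theorem1p1 {n : ℕ} {M : Type*} [TopologicalSpace M]
    [ChartedSpace (EuclideanSpace ℝ (Fin (2 * n))) M] [IsManifold (𝓡 (2 * n)) ∞ M]
    (F : M → Heis n) (hF : IsImmersedHypersurface F) (hmin : IsMinimal F)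
    (U : Set M) (hU : IsOpen U) (hUF : U ⊆ nonChar F)
    (N : M → Vec n) (hN : IsUnitNormal F U N)
    (E : Fin (2 * n - 1) → M → Vec n) (hE : IsHorFrame F U E)
    (X Y : M → Vec n) (hX : IsHorTangentField F U X) (hY : IsHorTangentField F U Y) :
    ∀ x ∈ U,
      lap F N E (sff F N) ![X, Y] x =
        -stability F N E x * sff F N ![X, Y] x + 8 * alpha N x ^ 2 * sff F N ![X, Y] x
        + 4 * hess F N (ofFun (alpha N)) ![proj N (JF X), Y] x
        + 4 * hess F N (ofFun (alpha N)) ![X, proj N (JF Y)] x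
        + (16 * alpha N x * dirDeriv F (proj N (JF X)) (alpha N) x
            - 8 * alpha N x ^ 2 * sff F N ![X, JF (nu N)] x
            + 4 * dirDeriv F (cov F X (nu N)) (alpha N) x) * inner ℝ (Y x) (JF (nu N) x)
        - 2 * dirDeriv F X (alpha N) x * sff F N ![Y, JF (nu N)] x
        - 2 * dirDeriv F Y (alpha N) x * sff F N ![X, JF (nu N)] x
        + 2 * alpha N x * sff F N ![Y, cov F (proj N (JF X)) (nu N)] x
        - 2 * alpha N x * inner ℝ (cov F X (cov F (JF (nu N)) (nu N)) x) (Y x)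
        - 4 * alpha N x ^ 2 * sff F N ![proj N (JF X), proj N (JF Y)] x
        + 2 * alpha N x * inner ℝ (JF (cov F X (nu N)) x) (cov F Y (nu N) x) := by
  intro x hx
  obtain ⟨η, Λ, ν, α, e, L⟩ := exists_localData hF hU hUF hN hE x
  have hs := mem_chart_source (EuclideanSpace ℝ (Fin (2 * n))) x
  have hxφ := (chartAt (EuclideanSpace ℝ (Fin (2 * n))) x).left_inv hs
  have hy : chartAt (EuclideanSpace ℝ (Fin (2 * n))) x x ∈
      (chartAt (EuclideanSpace ℝ (Fin (2 * n))) x).target ∩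
        (chartAt (EuclideanSpace ℝ (Fin (2 * n))) x).symm ⁻¹' U :=
    ⟨(chartAt (EuclideanSpace ℝ (Fin (2 * n))) x).map_source hs, by
      rw [Set.mem_preimage, hxφ]
      exact hx⟩
  obtain ⟨X', rX⟩ := LocalParam.exists_repVec (contDiffOn_chart_symm x hX.smooth)
  obtain ⟨Y', rY⟩ := LocalParam.exists_repVec (contDiffOn_chart_symm x hY.smooth)
  have mX := LocalParam.repVec_mem hN (fun y => y.2.2) L.rep_nu rX hX
  have mY := LocalParam.repVec_mem hN (fun y => y.2.2) L.rep_nu rY hY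
  have hH : ∑ j, FrameField.ip (FrameField.conn L.D (e j) ν) (e j) = 0 := by
    refine SmoothFun.ext_of_ev fun z => ?_
    rw [map_sum, map_zero, ← hmin U hU hUF N hN E hE _ z.2.2]
    exact Finset.sum_congr rfl fun j _ =>
      (L.rep_sff (L.rep_frame j) (L.isHypersurface.frame_mem j) (L.rep_frame j) z).symm
  have h := L.simons (one_le_of_horNormal_ne_zero (horNormal_ne_zero hF hUF hN hx)) hH rX mX rY mY
    ⟨_, hy⟩
  rw [hxφ] at h
  exact h
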